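/- **Positive face structures.** A positive hypergraph $T$ consists of finite sets $T_k$ ($k\in\omega$, only finitely many of them non-empty), functions $\gamma:T_{k+1}\to T_k$, and for each $a\in T_{k+1}$ a non-empty set $\delta(a)\subseteq T_k$, which is a singleton for $a\in T_1$. The sets $T_k$ are regarded as disjoint, $T$ also denotes their union, and $\gamma(A)$, $\delta(A)$ denote images of sets of faces. On $T_k$ let $<^+$ be the transitive closure of the relation "$a\in\delta(\alpha)$ and $\gamma(\alpha)=b$ for some $\alpha\in T_{k+1}$"; for $k>0$ let $<^-$ be the transitive closure of the relation $\gamma(a)\in\delta(b)$; on $T_0$ let $<^-$ be empty. Write $a\perp^{\pm} b$ if $a<^{\pm}b$ or $b<^{\pm}a$. $T$ is a *positive face structure* if $T_0\ne\emptyset$ and 1. for $a\in T_{\ge 2}$: $\{\gamma\gamma(a)\}=\gamma\delta(a)-\delta\delta(a)$ and $\delta\gamma(a)=\delta\delta(a)-\gamma\delta(a)$; 2. each $<^+$ is a strict order, and it is linear on $T_0$; 3. for $k>0$ no two faces in $T_k$ satisfy both $a\perp^-b$ and $a\perp^+b$; 4. for $k>0$ and $x\in T_{k-1}$ the sets $\{a\in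 T_k:\gamma(a)=x\}$ and $\{a\in T_k: x\in\delta(a)\}$ are linearly ordered by $<^+$. We put $<^\sim\,=\,<^-$ on a positive face structure. **Ordered face structures.** For sets $S_k$ let $1_{S_{k-1}}=\{1_u:u\in S_{k-1}\}$ be the set of empty faces of dimension $k$ ($S_{-1}=\emptyset$). A hypergraph $S$ consists of finite sets $S_k$ (finitely many non-empty), functions $\gamma:S_{k+1}\sqcup 1_{S_k}\to S_k$, and sets $\delta(a)\subseteq S_k\sqcup 1_{S_{k-1}}$ for $a\in S_{k+1}\sqcup 1_{S_k}$, each of them a singleton or a non-empty subset of $S_k$, and a singleton when $k=0$. Put $\dot\delta(a)=\delta(a)\cap S$, $\theta(a)=\delta(a)\cup\{\gamma(a)\}$ and $\dot\theta(a)=\theta(a)\cap S$. A face $a\in S_{\ge1}$ is a *loop*, $a\in S^\lambda$, if $\delta(a)=\{\gamma(a)\}$; $a\in S^\varepsilon$ if $\delta(a)=\{1_u\}$ for some $u$; $S^{-\lambda}=S-S^\lambda$; $\dot\delta^{-\lambda}(a)=\dot\delta(a)-S^\lambda$; and $\iota(b)=\gamma\dot\delta^{-\lambda}(b)\cap\delta\dot\delta^{-\lambda}(b)$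 for $b\in S_{\geq 2}$. The relations $<^-$, $\perp^-$ are defined as above; $<^+$, $\perp^+$ likewise, but using only $\alpha\in S^{-\lambda}$. For $A,B\subseteq S_k\sqcup1_{S_{k-1}}$ write $A\equiv_1B$ if $A\cup 1_{\dot\theta(A\cap S)}=B\cup1_{\dot\theta(B\cap S)}$ (where $\dot\theta$ of $0$-dimensional faces is empty). An *ordered face structure* is a hypergraph $S$ with a binary relation $<^\sim$ on each $S_k$ (write $a\perp^\sim b$ if $a<^\sim b$ or $b<^\sim a$) such that $S_0\ne\emptyset$ and 1. for $a\in S_{\ge2}$: $\{\gamma\gamma(a)\}=\gamma\delta(a)-\delta\dot\delta^{-\lambda}(a)$ and $\delta\gamma(a)\equiv_1\delta\delta(a)-\gamma\dot\delta^{-\lambda}(a)$; and $\delta(1_x)=\{x\}$, $\gamma(1_x)=x$ for $x\in S$; 2. if $x,y\in\dot\delta(a)$ then not $x\perp^+y$; 3. $<^+$ on each $S_k$ and $<^\sim$ on each $S_{k+1}$ are strict orders (irreflexive and transitive), and $<^+$ on $S_0$ is linear; 4. for $a,b\in S_k$: if $k>0$, not both $a\perp^\sim b$ and $a\perp^+b$;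 if $a<^\sim b$ then $a<^-b$; and if $k>0$ and $\theta(a)\cap\theta(b)=\emptyset$, then $a<^\sim b$ iff $a<^-b$; 5. if $a\neq b$ in $S_{\ge1}$ and $\dot\theta(a)\cap\dot\theta(b)\neq\emptyset$ then $a\perp^\sim b$ or $a\perp^+b$; if $a\in S^\varepsilon$ and $b$ are in $S_{\ge2}$ and $\gamma\gamma(a)\in\iota(b)$, then $a<^\sim b$ or $a<^+b$; 6. $S^\lambda\subseteq\gamma(S^{-\lambda})$. **Collapsing morphisms.** A *collapsing morphism* $f:T\to S$ is a family of maps $f_k:T_k\to S_k\sqcup1_{S_{k-1}}$ such that for $k>0$ and $a,b\in T_k$: if $a<^\sim b$ and $f(a),f(b)\in S_k$ then $f(a)<^\sim f(b)$; $f(\gamma(a))=\gamma(f(a))$; and $f(\delta(a))\equiv_1\delta(f(a))$ (here $\gamma(1_x)=x$ and $\delta(1_x)=\{x\}$). Its *kernel* is $\ker f=f^{-1}(1_S)$. **Quotients.** Let $T$ be a positive face structure and $T^u=\{a\in T_{\ge1}:|\delta(a)|=1\}$ the set of its unary faces. A set $\mathcal J\subseteq T^u$ is an *ideal* if $\mathcal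 J\cap\gamma(T)=\emptyset$ and $\mathcal J\cap\delta(\mathcal J)=\emptyset$; put $\mathcal J_k=\mathcal J\cap T_k$. On $T_k$ let $\sim$ be the least equivalence relation with $x\sim x'$ whenever $\delta(a)=\{x\}$ and $\gamma(a)=x'$ for some $a\in\mathcal J_{k+1}$. The quotient $T_{/\mathcal J}$ has $(T_{/\mathcal J})_k=(T_k-\mathcal J_k)/{\sim}$, $\gamma([a])=[\gamma(a)]$, $\delta([a])=\{1_{[\gamma\gamma(a)]}\}$ if $\delta(a)\subseteq\mathcal J$ and $\delta([a])=\{[x]:x\in\delta(a)-\mathcal J\}$ otherwise, $\gamma(1_x)=x$ and $\delta(1_x)=\{x\}$ on empty faces, and $[x]<^\sim[x']$ iff $x<^-x'$ in $T$ (all of this is well defined). The quotient map $q_{\mathcal J}:T\to T_{/\mathcal J}$ sends $a$ to $1_{[\gamma(a)]}$ if $a\in\mathcal J$ and to $[a]$ otherwise. **Theorem.** Let $T$ be a positive face structure and $\mathcal J\subseteq T^u$ an ideal. Then $T_{/\mathcal J}$ is an ordered face structure, and $q_{\mathcal J}:T\to T_{/\mathcal J}$ is a collapsing morphism with kernel $\mathcal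 J$. -/

import Mathlib

universe u

namespace FaceStructures

/-! ## Faces and empty faces -/

/-- The set `S_k ⊔ 1_{S_{k-1}}` of faces and empty faces of dimension `k` (with `S_{-1} = ∅`);
`empty x` is the empty face `1_x` on the face `x`. -/
inductive Cell (F : ℕ → Type u) : ℕ → Type u
  | face {k : ℕ} (x : F k) : Cell F k
  | empty {k : ℕ} (x : F k) : Cell F (k + 1)

/-- The set `1_S` of empty faces, in dimension `k`. -/
def emptyFaces (F : ℕ → Type u) : (k : ℕ) → Set (Cell F k)
  | 0 => ∅
  | _ + 1 => Set.range Cell.empty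

/-! ## Hypergraphs -/

/-- A hypergraph. Both `γ` and `δ` are also defined on the empty faces. -/
structure Hypergraph where
  Face : ℕ → Type u
  finite_face : ∀ k, Finite (Face k)
  bounded : ∃ n, ∀ k, n ≤ k → IsEmpty (Face k)
  γ : {k : ℕ} → Cell Face (k + 1) → Face k
  δ : {k : ℕ} → Cell Face (k + 1) → Set (Cell Face k)
  δ_shape : ∀ {k : ℕ} (a : Cell Face (k + 1)),
    (∃ c, δ a = {c}) ∨ ((δ a).Nonempty ∧ δ a ⊆ Set.range Cell.face)
  δ_zero : ∀ a : Cell Face 1, ∃ x, δ a = {Cell.face x}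

/-- An ordered hypergraph: a hypergraph with a binary relation `<^∼` on each set of faces. -/
structure OrderedHypergraph extends Hypergraph.{u} where
  lt : (k : ℕ) → Face k → Face k → Prop

namespace Hypergraph

variable (S : Hypergraph.{u})

/-- The codomain of a (non-empty) face. -/
def cod {k : ℕ} (a : S.Face (k + 1)) : S.Face k := S.γ (Cell.face a)

/-- The domain of a (non-empty) face. -/
def dom {k : ℕ} (a : S.Face (k + 1)) : Set (Cell S.Face k) := S.δ (Cell.face a)

/-- `γ` on sets of faces and empty faces. -/
def γSet {k : ℕ} (A : Set (Cell S.Face (k + 1))) : Set (Cell S.Face k) :=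
  {c | ∃ a ∈ A, c = Cell.face (S.γ a)}

/-- `δ` on sets of faces and empty faces. -/
def δSet {k : ℕ} (A : Set (Cell S.Face (k + 1))) : Set (Cell S.Face k) :=
  {c | ∃ a ∈ A, c ∈ S.δ a}

/-- `θ(a) = δ(a) ∪ γ(a)`. -/
def θ {k : ℕ} (a : S.Face (k + 1)) : Set (Cell S.Face k) :=
  S.dom a ∪ {Cell.face (S.cod a)}

/-- The set `S^λ` of loops: faces `a` with `δ(a) = γ(a)`. -/
def loops : (k : ℕ) → Set (S.Face k)
  | 0 => ∅
  | _ + 1 => {a | S.dom a = {Cell.face (S.cod a)}}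

/-- The set `S^ε` of empty-domain faces. -/
def emptyDomain : (k : ℕ) → Set (S.Face k)
  | 0 => ∅
  | k + 1 => {a | ∃ c ∈ emptyFaces S.Face k, S.dom a = {c}}

/-- The faces in the domain of `a` that are not loops. -/
def domNonloop {k : ℕ} (a : S.Face (k + 1)) : Set (Cell S.Face k) :=
  {c | ∃ x, x ∉ S.loops k ∧ Cell.face x ∈ S.dom a ∧ c = Cell.face x}

/-- The set `ι(a)` of internal faces of `a`. -/
def internal {k : ℕ} (a : S.Face (k + 2)) : Set (Cell S.Face k) :=
  S.γSet (S.domNonloop a) ∩ S.δSet (S.domNonloop a)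

/-- The set `1_{θ(A ∩ S)}` of empty faces on the faces that are in `θ(x)` for a face `x ∈ A`. -/
def oneθ {k : ℕ} (A : Set (Cell S.Face (k + 1))) : Set (Cell S.Face (k + 1)) :=
  {c | ∃ x : S.Face (k + 1), Cell.face x ∈ A ∧
    ∃ y : S.Face k, Cell.face y ∈ S.θ x ∧ c = Cell.empty y}

/-- The relation `A ≡₁ B`, i.e. `A ∪ 1_{θ(A ∩ S)} = B ∪ 1_{θ(B ∩ S)}`. -/
def OneEq : {k : ℕ} → Set (Cell S.Face k) → Set (Cell S.Face k) → Prop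
  | 0, A, B => A = B
  | _ + 1, A, B => A ∪ S.oneθ A = B ∪ S.oneθ B

/-- The relation `<^-`. -/
def ltMinus : (k : ℕ) → S.Face k → S.Face k → Prop
  | 0 => fun _ _ => False
  | _ + 1 => Relation.TransGen fun a b => Cell.face (S.cod a) ∈ S.dom b

/-- The upper order `<^+`. -/
def ltPlus (k : ℕ) : S.Face k → S.Face k → Prop :=
  Relation.TransGen fun a b =>
    ∃ α : S.Face (k + 1), α ∉ S.loops (k + 1) ∧ Cell.face a ∈ S.dom α ∧ S.cod α = b

end Hypergraph

/-! ## Ordered face structures -/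

namespace OrderedHypergraph

variable (S : OrderedHypergraph.{u})

/-- `a ⊥^+ b`. -/
def PerpPlus {k : ℕ} (a b : S.Face k) : Prop := S.ltPlus k a b ∨ S.ltPlus k b a

/-- `a ⊥^∼ b`. -/
def PerpSim {k : ℕ} (a b : S.Face k) : Prop := S.lt k a b ∨ S.lt k b a

/-- An ordered hypergraph is an ordered face structure. -/
structure IsOrderedFaceStructure : Prop where
  nonempty : Nonempty (S.Face 0)
  γ_globularity : ∀ {k : ℕ} (a : S.Face (k + 2)),
    ({Cell.face (S.cod (S.cod a))} : Set (Cell S.Face k)) =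
      S.γSet (S.dom a) \ S.δSet (S.domNonloop a)
  δ_globularity : ∀ {k : ℕ} (a : S.Face (k + 2)),
    S.OneEq (S.dom (S.cod a)) (S.δSet (S.dom a) \ S.γSet (S.domNonloop a))
  δ_empty : ∀ {k : ℕ} (x : S.Face k), S.δ (Cell.empty x) = {Cell.face x}
  γ_empty : ∀ {k : ℕ} (x : S.Face k), S.γ (Cell.empty x) = x
  local_discreteness : ∀ {k : ℕ} (a : S.Face (k + 1)) (x y : S.Face k),
    Cell.face x ∈ S.dom a → Cell.face y ∈ S.dom a → ¬ S.PerpPlus x y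
  ltPlus_irrefl : ∀ {k : ℕ} (x : S.Face k), ¬ S.ltPlus k x x
  ltPlus_trans : ∀ {k : ℕ} (x y z : S.Face k),
    S.ltPlus k x y → S.ltPlus k y z → S.ltPlus k x z
  lt_irrefl : ∀ {k : ℕ} (x : S.Face (k + 1)), ¬ S.lt (k + 1) x x
  lt_trans : ∀ {k : ℕ} (x y z : S.Face (k + 1)),
    S.lt (k + 1) x y → S.lt (k + 1) y z → S.lt (k + 1) x z
  ltPlus_linear : ∀ x y : S.Face 0, x ≠ y → S.PerpPlus x y
  disjointness : ∀ {k : ℕ} (a b : S.Face (k + 1)), ¬ (S.PerpSim a b ∧ S.PerpPlus a b)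
  lt_le_ltMinus : ∀ {k : ℕ} (a b : S.Face k), S.lt k a b → S.ltMinus k a b
  lt_iff_ltMinus : ∀ {k : ℕ} (a b : S.Face (k + 1)), S.θ a ∩ S.θ b = ∅ →
    (S.lt (k + 1) a b ↔ S.ltMinus (k + 1) a b)
  pencil_linearity : ∀ {k : ℕ} (a b : S.Face (k + 1)), a ≠ b →
    (∃ x : S.Face k, Cell.face x ∈ S.θ a ∩ S.θ b) → S.PerpSim a b ∨ S.PerpPlus a b
  pencil_linearity_emptyDomain : ∀ {k : ℕ} (a b : S.Face (k + 2)),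
    a ∈ S.emptyDomain (k + 2) → Cell.face (S.cod (S.cod a)) ∈ S.internal b →
    S.lt (k + 2) a b ∨ S.ltPlus (k + 2) a b
  loop_filling : ∀ {k : ℕ} (x : S.Face k), x ∈ S.loops k →
    ∃ a : S.Face (k + 1), a ∉ S.loops (k + 1) ∧ S.cod a = x

/-! ## Collapsing morphisms -/

variable {S} {T : OrderedHypergraph.{u}}

/-- The image of a set of faces and empty faces under a family of maps
`f_k : T_k → S_k ⊔ 1_{S_{k-1}}`, where an empty face `1_x` such that `f(x)` is a face is sent
to `1_{f(x)}`. -/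
def image (f : (k : ℕ) → T.Face k → Cell S.Face k) :
    {k : ℕ} → Set (Cell T.Face k) → Set (Cell S.Face k)
  | 0, A => {c | ∃ x, Cell.face x ∈ A ∧ c = f 0 x}
  | k + 1, A => {c | (∃ x, Cell.face x ∈ A ∧ c = f (k + 1) x) ∨
      ∃ x y, Cell.empty x ∈ A ∧ f k x = Cell.face y ∧ c = Cell.empty y}

/-- A family of maps `f_k : T_k → S_k ⊔ 1_{S_{k-1}}` is a collapsing morphism. -/
structure IsCollapsingMorphism (f : (k : ℕ) → T.Face k → Cell S.Face k) : Prop where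
  map_lt : ∀ {k : ℕ} (a b : T.Face (k + 1)) (a' b' : S.Face (k + 1)), T.lt (k + 1) a b →
    f (k + 1) a = Cell.face a' → f (k + 1) b = Cell.face b' → S.lt (k + 1) a' b'
  map_γ : ∀ {k : ℕ} (a : T.Face (k + 1)), f k (T.cod a) = Cell.face (S.γ (f (k + 1) a))
  map_δ : ∀ {k : ℕ} (a : T.Face (k + 1)), S.OneEq (image f (T.dom a)) (S.δ (f (k + 1) a))

/-- The kernel `f⁻¹(1_S)`. -/
def ker (f : (k : ℕ) → T.Face k → Cell S.Face k) (k : ℕ) : Set (T.Face k) :=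
  {a | f k a ∈ emptyFaces S.Face k}

end OrderedHypergraph

/-! ## Positive face structures -/

/-- A positive hypergraph: the domain of a face is a non-empty set of faces. -/
structure PositiveHypergraph where
  Face : ℕ → Type u
  finite_face : ∀ k, Finite (Face k)
  bounded : ∃ n, ∀ k, n ≤ k → IsEmpty (Face k)
  γ : {k : ℕ} → Face (k + 1) → Face k
  δ : {k : ℕ} → Face (k + 1) → Set (Face k)
  δ_nonempty : ∀ {k : ℕ} (a : Face (k + 1)), (δ a).Nonempty
  δ_zero : ∀ a : Face 1, ∃ x, δ a = {x}

namespace PositiveHypergraph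

variable (T : PositiveHypergraph.{u})

/-- The lower order `<^-`. -/
def ltMinus : (k : ℕ) → T.Face k → T.Face k → Prop
  | 0 => fun _ _ => False
  | _ + 1 => Relation.TransGen fun a b => T.γ a ∈ T.δ b

/-- The upper order `<^+`. -/
def ltPlus (k : ℕ) : T.Face k → T.Face k → Prop :=
  Relation.TransGen fun a b => ∃ α : T.Face (k + 1), a ∈ T.δ α ∧ T.γ α = b

end PositiveHypergraph

/-- A positive face structure. -/
structure PositiveFaceStructure extends PositiveHypergraph.{u} where
  nonempty : Nonempty (Face 0)
  γ_globularity : ∀ {k : ℕ} (a : Face (k + 2)), {γ (γ a)} = (γ '' δ a) \ ⋃ x ∈ δ a, δ x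
  δ_globularity : ∀ {k : ℕ} (a : Face (k + 2)), δ (γ a) = (⋃ x ∈ δ a, δ x) \ (γ '' δ a)
  ltPlus_irrefl : ∀ {k : ℕ} (x : Face k), ¬ toPositiveHypergraph.ltPlus k x x
  ltPlus_linear : ∀ x y : Face 0, x ≠ y →
    toPositiveHypergraph.ltPlus 0 x y ∨ toPositiveHypergraph.ltPlus 0 y x
  disjointness : ∀ {k : ℕ} (a b : Face (k + 1)),
    ¬ ((toPositiveHypergraph.ltMinus (k + 1) a b ∨ toPositiveHypergraph.ltMinus (k + 1) b a) ∧
      (toPositiveHypergraph.ltPlus (k + 1) a b ∨ toPositiveHypergraph.ltPlus (k + 1) b a))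
  γ_pencil_linearity : ∀ {k : ℕ} (a b : Face (k + 1)), a ≠ b → γ a = γ b →
    toPositiveHypergraph.ltPlus (k + 1) a b ∨ toPositiveHypergraph.ltPlus (k + 1) b a
  δ_pencil_linearity : ∀ {k : ℕ} (a b : Face (k + 1)), a ≠ b → (δ a ∩ δ b).Nonempty →
    toPositiveHypergraph.ltPlus (k + 1) a b ∨ toPositiveHypergraph.ltPlus (k + 1) b a

namespace PositiveFaceStructure

variable (T : PositiveFaceStructure.{u})

/-- A positive face structure as an ordered hypergraph, where `<^∼` is `<^-`. -/
def toOrderedHypergraph : OrderedHypergraph.{u} where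
  Face := T.Face
  finite_face := T.finite_face
  bounded := T.bounded
  γ := fun
    | Cell.face a => T.γ a
    | Cell.empty x => x
  δ := fun
    | Cell.face a => Cell.face '' T.δ a
    | Cell.empty x => {Cell.face x}
  δ_shape := by
    rintro k (a | x)
    · exact Or.inr ⟨(T.δ_nonempty a).image _, Set.image_subset_range _ _⟩
    · exact Or.inl ⟨_, rfl⟩
  δ_zero := by
    rintro (a | x)
    · obtain ⟨x, hx⟩ := T.δ_zero a
      exact ⟨x, by simp [hx]⟩
    · exact ⟨x, rfl⟩
  lt := T.ltMinus

/-- The set `T^u` of unary faces. -/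
def unary : (k : ℕ) → Set (T.Face k)
  | 0 => ∅
  | _ + 1 => {a | (T.δ a).ncard = 1}

/-- Ideals of unary faces. -/
structure IsIdeal (J : (k : ℕ) → Set (T.Face k)) : Prop where
  subset_unary : ∀ k, J k ⊆ T.unary k
  γ_notMem : ∀ {k : ℕ} (a : T.Face (k + 1)), T.γ a ∉ J k
  δ_notMem : ∀ {k : ℕ} (a : T.Face (k + 1)), a ∈ J (k + 1) → ∀ x ∈ T.δ a, x ∉ J k

variable {T} {J : (k : ℕ) → Set (T.Face k)}

/-- The relation generating `∼_J`: there is `a ∈ J` with `δ(a) = x` and `γ(a) = x'`. -/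
def Step (J : (k : ℕ) → Set (T.Face k)) (k : ℕ) (x x' : T.Face k) : Prop :=
  ∃ a ∈ J (k + 1), T.δ a = {x} ∧ T.γ a = x'

/-- The restriction to `T_k - J_k` of the least equivalence relation on `T_k` that contains
`Step J k`. -/
def quotientSetoid (J : (k : ℕ) → Set (T.Face k)) (k : ℕ) : Setoid {x : T.Face k // x ∉ J k} :=
  (Relation.EqvGen.setoid (Step J k)).comap Subtype.val

/-- The set `(T_k - J_k)/∼` of faces of the quotient. -/
def QuotientFace (J : (k : ℕ) → Set (T.Face k)) (k : ℕ) : Type u :=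
  Quotient (quotientSetoid J k)

/-- The class `[x]` of a face `x ∉ J`. -/
def cls {k : ℕ} (x : T.Face k) (hx : x ∉ J k) : QuotientFace J k :=
  Quotient.mk (quotientSetoid J k) ⟨x, hx⟩

theorem γ_eq_of_step {k : ℕ} {x y : T.Face (k + 1)} (h : Step J (k + 1) x y) :
    T.γ x = T.γ y := by
  obtain ⟨a, -, hx, rfl⟩ := h
  have h1 := T.γ_globularity a
  have h2 : T.γ (T.γ a) ∈ (T.γ '' T.δ a) \ ⋃ z ∈ T.δ a, T.δ z := h1 ▸ rfl
  have h3 := h2.1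
  rw [hx] at h3
  obtain ⟨z, rfl, hz⟩ := h3
  exact hz

theorem δ_eq_of_step {k : ℕ} {x y : T.Face (k + 1)} (h : Step J (k + 1) x y) :
    T.δ x = T.δ y := by
  have h0 := γ_eq_of_step h
  obtain ⟨a, -, hx, rfl⟩ := h
  have h1 := T.γ_globularity a
  have h2 : T.γ (T.γ a) ∈ (T.γ '' T.δ a) \ ⋃ z ∈ T.δ a, T.δ z := h1 ▸ rfl
  have h3 := h2.2
  have h4 := T.δ_globularity a
  simp only [hx, Set.biUnion_singleton, Set.image_singleton] at h3 h4
  rw [h4, h0, Set.sdiff_singleton_eq_self h3]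

theorem γδ_eq_of_rel {k : ℕ} {x y : {x : T.Face (k + 1) // x ∉ J (k + 1)}}
    (h : (quotientSetoid J (k + 1)).r x y) : T.γ x.1 = T.γ y.1 ∧ T.δ x.1 = T.δ y.1 := by
  have h' : Relation.EqvGen (Step J (k + 1)) x.1 y.1 := h
  clear h
  generalize x.1 = x at h' ⊢
  generalize y.1 = y at h' ⊢
  induction h' with
  | rel _ _ h => exact ⟨γ_eq_of_step h, δ_eq_of_step h⟩
  | refl => exact ⟨rfl, rfl⟩
  | symm _ _ _ ih => exact ⟨ih.1.symm, ih.2.symm⟩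
  | trans _ _ _ _ _ ih₁ ih₂ => exact ⟨ih₁.1.trans ih₂.1, ih₁.2.trans ih₂.2⟩

/-- `γ_{/J}([a]) = [γ(a)]`. -/
def quotientγ (hJ : T.IsIdeal J) {k : ℕ} : QuotientFace J (k + 1) → QuotientFace J k :=
  Quotient.lift (fun a => cls (T.γ a.1) (hJ.γ_notMem a.1)) fun a b h => by
    simp only [(γδ_eq_of_rel h).1]

open Classical in
/-- The set `δ_{/J}([a])` in terms of a representative `a`. -/
noncomputable def quotientδAux (hJ : T.IsIdeal J) :
    {k : ℕ} → T.Face (k + 1) → Set (Cell (QuotientFace J) k)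
  | 0, a => {c | ∃ x ∈ T.δ a, ∃ hx : x ∉ J 0, c = Cell.face (cls x hx)}
  | k + 1, a =>
    if T.δ a ⊆ J (k + 1) then {Cell.empty (cls (T.γ (T.γ a)) (hJ.γ_notMem (T.γ a)))}
    else {c | ∃ x ∈ T.δ a, ∃ hx : x ∉ J (k + 1), c = Cell.face (cls x hx)}

theorem quotientδAux_congr (hJ : T.IsIdeal J) {k : ℕ} {a b : T.Face (k + 1)}
    (h : T.γ a = T.γ b ∧ T.δ a = T.δ b) : quotientδAux hJ a = quotientδAux hJ b := by
  obtain ⟨h1, h2⟩ := h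
  cases k with
  | zero => simp only [quotientδAux, h2]
  | succ k =>
    by_cases h : T.δ b ⊆ J (k + 1)
    · have h' : T.δ a ⊆ J (k + 1) := h2 ▸ h
      simp only [quotientδAux, h1, if_pos h, if_pos h']
    · have h' : ¬ T.δ a ⊆ J (k + 1) := h2 ▸ h
      simp only [quotientδAux, h2, if_neg h, if_neg h']

/-- `δ_{/J}([a])` is `1_{[γγ(a)]}` if `δ(a) ⊆ J`, and `{[x] : x ∈ δ(a) - J}` otherwise. -/
noncomputable def quotientδ (hJ : T.IsIdeal J) {k : ℕ} :
    QuotientFace J (k + 1) → Set (Cell (QuotientFace J) k) :=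
  Quotient.lift (fun a => quotientδAux hJ a.1) fun _ _ h =>
    quotientδAux_congr hJ (γδ_eq_of_rel h)

theorem ltMinus_congr {k : ℕ} {a a' b b' : T.Face (k + 1)} (ha : T.γ a = T.γ a')
    (hb : T.δ b = T.δ b') (h : T.ltMinus (k + 1) a b) : T.ltMinus (k + 1) a' b' := by
  have h1 : T.ltMinus (k + 1) a' b := by
    rcases Relation.TransGen.head'_iff.1 h with ⟨c, hc, hcb⟩
    exact Relation.TransGen.head'_iff.2 ⟨c, ha ▸ hc, hcb⟩
  rcases Relation.TransGen.tail'_iff.1 h1 with ⟨c, hac, hc⟩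
  exact Relation.TransGen.tail'_iff.2 ⟨c, hac, hb ▸ hc⟩

/-- `[x] <^∼ [x']` iff `x <^- x'`. -/
def quotientLt (J : (k : ℕ) → Set (T.Face k)) :
    (k : ℕ) → QuotientFace J k → QuotientFace J k → Prop
  | 0 => fun _ _ => False
  | k + 1 => Quotient.lift₂ (fun a b => T.ltMinus (k + 1) a.1 b.1) fun _ _ _ _ h₁ h₂ =>
      propext ⟨ltMinus_congr (γδ_eq_of_rel h₁).1 (γδ_eq_of_rel h₂).2,
        ltMinus_congr (γδ_eq_of_rel h₁).1.symm (γδ_eq_of_rel h₂).2.symm⟩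

theorem quotientδ_shape (hJ : T.IsIdeal J) {k : ℕ} (a : QuotientFace J (k + 1)) :
    (∃ c, quotientδ hJ a = {c}) ∨
      ((quotientδ hJ a).Nonempty ∧ quotientδ hJ a ⊆ Set.range Cell.face) := by
  induction a using Quotient.inductionOn with | _ a
  obtain ⟨a, ha⟩ := a
  change (∃ c, quotientδAux hJ a = {c}) ∨
      ((quotientδAux hJ a).Nonempty ∧ quotientδAux hJ a ⊆ Set.range Cell.face)
  cases k with
  | zero =>
    obtain ⟨x, hx⟩ := T.δ_nonempty a
    have hx' : x ∉ J 0 := fun h => hJ.subset_unary 0 h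
    refine Or.inr ⟨⟨_, x, hx, hx', rfl⟩, ?_⟩
    rintro _ ⟨y, -, hy, rfl⟩
    exact ⟨_, rfl⟩
  | succ k =>
    by_cases h : T.δ a ⊆ J (k + 1)
    · exact Or.inl ⟨_, if_pos h⟩
    · obtain ⟨x, hx, hx'⟩ := Set.not_subset.1 h
      simp only [quotientδAux, if_neg h]
      refine Or.inr ⟨⟨_, x, hx, hx', rfl⟩, ?_⟩
      rintro _ ⟨y, -, hy, rfl⟩
      exact ⟨_, rfl⟩

theorem quotientδ_zero (hJ : T.IsIdeal J) (a : QuotientFace J 1) :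
    ∃ x, quotientδ hJ a = {Cell.face x} := by
  induction a using Quotient.inductionOn with | _ a
  obtain ⟨a, ha⟩ := a
  obtain ⟨x, hx⟩ := T.δ_zero a
  have hx' : x ∉ J 0 := fun h => hJ.subset_unary 0 h
  refine ⟨cls x hx', ?_⟩
  change quotientδAux hJ a = _
  ext c
  simp only [quotientδAux, hx, Set.mem_ofPred_eq, Set.mem_singleton_iff]
  constructor
  · rintro ⟨y, rfl, _, rfl⟩
    rfl
  · rintro rfl
    exact ⟨x, rfl, hx', rfl⟩

/-- The quotient `T_{/J}`, with `γ(1_x) = x = δ(1_x)` on empty faces. -/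
noncomputable def quotient (T : PositiveFaceStructure.{u}) (J : (k : ℕ) → Set (T.Face k))
    (hJ : T.IsIdeal J) : OrderedHypergraph.{u} where
  Face := QuotientFace J
  finite_face := fun k => by
    have := T.finite_face k
    exact Quotient.finite _
  bounded := by
    obtain ⟨n, hn⟩ := T.bounded
    refine ⟨n, fun k hk => ⟨fun a => ?_⟩⟩
    induction a using Quotient.inductionOn with | _ a
    exact (hn k hk).false a.1
  γ := fun
    | Cell.face a => quotientγ hJ a
    | Cell.empty x => x
  δ := fun
    | Cell.face a => quotientδ hJ a
    | Cell.empty x => {Cell.face x}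
  δ_shape := by
    rintro k (a | x)
    · exact quotientδ_shape hJ a
    · exact Or.inl ⟨_, rfl⟩
  δ_zero := by
    rintro (a | x)
    · exact quotientδ_zero hJ a
    · exact ⟨x, rfl⟩
  lt := quotientLt J

open Classical in
/-- The quotient map: `q_J(a)` is `1_{[γ(a)]}` if `a ∈ J`, and `[a]` otherwise. -/
noncomputable def quotientMap (T : PositiveFaceStructure.{u}) (J : (k : ℕ) → Set (T.Face k))
    (hJ : T.IsIdeal J) : (k : ℕ) → T.Face k → Cell (QuotientFace J) k
  | 0, a => Cell.face (cls a fun h => hJ.subset_unary 0 h)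
  | k + 1, a =>
    if h : a ∈ J (k + 1) then Cell.empty (cls (T.γ a) (hJ.γ_notMem a)) else Cell.face (cls a h)

end PositiveFaceStructure

end FaceStructures

namespace FaceStructures

namespace PositiveFaceStructure

/-! ## The upper order of a positive face structure -/

variable {T : PositiveFaceStructure.{u}}

/-! The lower order is governed by the upper one: `a <^- b` holds exactly when `γ(a) ≤ y` for some
`y ∈ δ(b)` (`ltMinus_of_le`, `exists_le_of_ltMinus`). Consequently every question about the quotient
becomes one about `≤`. Three facts about `T` carry the rest: a domain `δ(a)` is an antichain
(`not_lt_of_mem_δ`); it is a tree with root codomain `γγ(a)` and leaves `δγ(a)` (`root_induction`,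
`leaf_induction`); and the faces above a given face form a chain (`le_total_of_le`).

An ideal avoids codomains, so its members are minimal for `<^+`. Hence a generating step `x → x'` of
`∼` is tight: everything strictly above `x` is above `x'`, and everything strictly below `x'` is
below `x`. Each `∼`-class is therefore a convex directed chain, and strict inequality between
inequivalent faces depends only on the classes (`lt_of_sim_left`, `lt_of_sim_right`). This gives
`[a] <^+ [b]` iff `a < b` and `a ≁ b` (`ltPlus_mk`).

Call a face collapsed if its domain is equivalent to its codomain; outside the ideal these are the
faces whose classes are loops. Globularity of the quotient follows by walking the tree `δ(a)` up or
down through collapsed faces until a non-collapsed one, the root or a leaf is reached; the empty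
faces that appear are absorbed by `≡₁`. Pencil linearity follows by sliding a shared face along its
class, and the empty-domain case (`pencil_emptyDomain`) by following the class of `γγ(a)` through
the tree of `b`. -/

/-- The upper order `<^+` as a partial order. -/
instance facePartialOrder (k : ℕ) : PartialOrder (T.Face k) where
  le x y := x = y ∨ T.ltPlus k x y
  lt x y := T.ltPlus k x y
  le_refl x := Or.inl rfl
  le_trans x y z := by
    rintro (rfl | h) (rfl | h')
    · exact Or.inl rfl
    · exact Or.inr h'
    · exact Or.inr h
    · exact Or.inr (Relation.TransGen.trans h h')
  le_antisymm x y := by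
    rintro (rfl | h) (h' | h')
    · rfl
    · rfl
    · exact h'.symm
    · exact absurd (Relation.TransGen.trans h h') (T.ltPlus_irrefl x)
  lt_iff_le_not_ge x y := by
    constructor
    · intro h
      refine ⟨Or.inr h, ?_⟩
      rintro (rfl | h')
      · exact T.ltPlus_irrefl _ h
      · exact T.ltPlus_irrefl _ (Relation.TransGen.trans h h')
    · rintro ⟨rfl | h, h'⟩
      · exact absurd (Or.inl rfl) h'
      · exact h

instance finite_faces (k : ℕ) : Finite (T.Face k) := T.finite_face k

theorem lt_γ {k : ℕ} {x : T.Face k} {α : T.Face (k + 1)} (h : x ∈ T.δ α) : x < T.γ α :=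
  Relation.TransGen.single ⟨α, h, rfl⟩

theorem exists_δ_of_lt {k : ℕ} {x y : T.Face k} (h : x < y) :
    ∃ α : T.Face (k + 1), x ∈ T.δ α ∧ T.γ α ≤ y := by
  rcases Relation.TransGen.head'_iff.1 h with ⟨c, ⟨α, hx, rfl⟩, hc⟩
  refine ⟨α, hx, ?_⟩
  rcases Relation.reflTransGen_iff_eq_or_transGen.1 hc with h | h
  · exact Or.inl h.symm
  · exact Or.inr h

theorem exists_γ_of_lt {k : ℕ} {x y : T.Face k} (h : x < y) :
    ∃ α : T.Face (k + 1), T.γ α = y ∧ ∃ c ∈ T.δ α, x ≤ c := by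
  rcases Relation.TransGen.tail'_iff.1 h with ⟨c, hc, ⟨α, hx, rfl⟩⟩
  refine ⟨α, rfl, c, hx, ?_⟩
  rcases Relation.reflTransGen_iff_eq_or_transGen.1 hc with h | h
  · exact Or.inl h.symm
  · exact Or.inr h

/-- An upper path from `γ(a)` to `y` is made of faces of the dimension of `a`, consecutive ones
linked by codomain and domain, so it is itself a lower path from `a` to `b`. -/
theorem ltMinus_of_le {k : ℕ} {a b : T.Face (k + 1)} {y : T.Face k} (h : T.γ a ≤ y)
    (hy : y ∈ T.δ b) : T.ltMinus (k + 1) a b := by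
  induction hn : y using WellFoundedLT.induction generalizing y b with
  | ind z ih =>
    subst hn
    rcases h.eq_or_lt with h | h
    · exact Relation.TransGen.single (h ▸ hy)
    · obtain ⟨α, rfl, c, hc, hac⟩ := exists_γ_of_lt h
      exact (ih c (lt_γ hc) hac hc rfl).tail hy

theorem exists_le_of_ltMinus {k : ℕ} {a b : T.Face (k + 1)} (h : T.ltMinus (k + 1) a b) :
    ∃ y ∈ T.δ b, T.γ a ≤ y := by
  induction h with
  | single h => exact ⟨_, h, le_rfl⟩
  | tail _ h ih =>
    obtain ⟨y, hy, hay⟩ := ih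
    exact ⟨_, h, hay.trans (lt_γ hy).le⟩

theorem ltMinus_irrefl {k : ℕ} (a : T.Face (k + 1)) : ¬ T.ltMinus (k + 1) a a := fun h => by
  obtain ⟨y, hy, h⟩ := exists_le_of_ltMinus h
  exact absurd (lt_γ hy) h.not_gt

theorem comparable_of_mem_δ {k : ℕ} {a b : T.Face (k + 1)} {x : T.Face k} (ha : x ∈ T.δ a)
    (hb : x ∈ T.δ b) : a ≤ b ∨ b < a := by
  by_cases h : a = b
  · exact Or.inl h.le
  · exact (T.δ_pencil_linearity a b h ⟨x, ha, hb⟩).imp Or.inr id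

theorem comparable_of_γ_eq {k : ℕ} {a b : T.Face (k + 1)} (h : T.γ a = T.γ b) :
    a ≤ b ∨ b < a := by
  by_cases h' : a = b
  · exact Or.inl h'.le
  · exact (T.γ_pencil_linearity a b h' h).imp Or.inr id

/-- The first face `β` on a path from `x` to `y` would satisfy `β <^- α`, while sharing `x` with `α`
gives `β = α` or `β ⊥^+ α`: irreflexivity of `<^-` excludes the former, disjointness the latter. -/
theorem not_lt_of_mem_δ {k : ℕ} {α : T.Face (k + 1)} {x y : T.Face k} (hx : x ∈ T.δ α)
    (hy : y ∈ T.δ α) : ¬ x < y := fun h => by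
  obtain ⟨β, hβ, hle⟩ := exists_δ_of_lt h
  have h1 : T.ltMinus (k + 1) β α := ltMinus_of_le hle hy
  by_cases h' : β = α
  · exact ltMinus_irrefl α (h' ▸ h1)
  · exact T.disjointness β α ⟨Or.inl h1, T.δ_pencil_linearity β α h' ⟨x, hβ, hx⟩⟩

theorem eq_of_le_of_mem_δ {k : ℕ} {α : T.Face (k + 1)} {x y : T.Face k} (hx : x ∈ T.δ α)
    (hy : y ∈ T.δ α) (h : x ≤ y) : x = y :=
  h.eq_or_lt.resolve_right (not_lt_of_mem_δ hx hy)

theorem eq_of_γ_eq_of_mem_δ {k : ℕ} {Φ : T.Face (k + 2)} {x y : T.Face (k + 1)}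
    (hx : x ∈ T.δ Φ) (hy : y ∈ T.δ Φ) (h : T.γ x = T.γ y) : x = y := by
  rcases comparable_of_γ_eq h with h | h
  · exact eq_of_le_of_mem_δ hx hy h
  · exact absurd h (not_lt_of_mem_δ hy hx)

/-! ### The tree of faces in a domain -/

theorem γ_eq_or_mem_δ {k : ℕ} {Φ : T.Face (k + 2)} {x : T.Face (k + 1)} (hx : x ∈ T.δ Φ) :
    T.γ x = T.γ (T.γ Φ) ∨ ∃ y ∈ T.δ Φ, T.γ x ∈ T.δ y := by
  by_cases h : T.γ x ∈ ⋃ y ∈ T.δ Φ, T.δ y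
  · simpa using Or.inr (Set.mem_iUnion₂.1 h)
  · have h1 : T.γ x ∈ (T.γ '' T.δ Φ) \ ⋃ x ∈ T.δ Φ, T.δ x := ⟨⟨x, hx, rfl⟩, h⟩
    rw [← T.γ_globularity Φ] at h1
    exact Or.inl h1

theorem mem_δγ_or_eq_γ {k : ℕ} {Φ : T.Face (k + 2)} {x : T.Face (k + 1)} {u : T.Face k}
    (hx : x ∈ T.δ Φ) (hu : u ∈ T.δ x) : u ∈ T.δ (T.γ Φ) ∨ ∃ y ∈ T.δ Φ, T.γ y = u := by
  by_cases h : u ∈ T.γ '' T.δ Φ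
  · exact Or.inr h
  · rw [T.δ_globularity Φ]
    exact Or.inl ⟨Set.mem_biUnion hx hu, h⟩

theorem exists_of_mem_δγ {k : ℕ} {Φ : T.Face (k + 2)} {u : T.Face k} (hu : u ∈ T.δ (T.γ Φ)) :
    ∃ x ∈ T.δ Φ, u ∈ T.δ x := by
  rw [T.δ_globularity Φ] at hu
  simpa using hu.1

/-- By globularity a codomain `γ(x)` is either `γγ(Φ)` or lies in the domain of a parent `y ∈ δ(Φ)`;
climbing terminates because codomains increase. -/
theorem root_induction {k : ℕ} (Φ : T.Face (k + 2)) {P : T.Face (k + 1) → Prop}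
    (root : ∀ x ∈ T.δ Φ, T.γ x = T.γ (T.γ Φ) → P x)
    (step : ∀ x ∈ T.δ Φ, ∀ y ∈ T.δ Φ, T.γ x ∈ T.δ y → P y → P x) : ∀ x ∈ T.δ Φ, P x := by
  intro x hx
  induction hn : T.γ x using WellFoundedGT.induction generalizing x with
  | ind z ih =>
    subst hn
    rcases γ_eq_or_mem_δ hx with h | ⟨y, hy, h⟩
    · exact root x hx h
    · exact step x hx y hy h (ih _ (lt_γ h) y hy rfl)

theorem leaf_induction {k : ℕ} (Φ : T.Face (k + 2)) {P : T.Face k → Prop}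
    (leaf : ∀ u ∈ T.δ (T.γ Φ), P u)
    (step : ∀ x ∈ T.δ Φ, (∀ u ∈ T.δ x, P u) → P (T.γ x)) :
    ∀ x ∈ T.δ Φ, ∀ u ∈ T.δ x, P u := by
  intro x hx u hu
  induction u using WellFoundedLT.induction generalizing x with
  | ind u ih =>
    rcases mem_δγ_or_eq_γ hx hu with h | ⟨y, hy, rfl⟩
    · exact leaf u h
    · exact step y hy fun v hv => ih v (lt_γ hv) y hy hv

theorem γ_le_γγ {k : ℕ} {Φ : T.Face (k + 2)} {x : T.Face (k + 1)} (hx : x ∈ T.δ Φ) :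
    T.γ x ≤ T.γ (T.γ Φ) :=
  root_induction Φ (P := fun x => T.γ x ≤ T.γ (T.γ Φ)) (fun _ _ h => h.le)
    (fun _ _ _ _ h h' => (lt_γ h).le.trans h') x hx

theorem exists_δγ_le {k : ℕ} {Φ : T.Face (k + 2)} {x : T.Face (k + 1)} {u : T.Face k}
    (hx : x ∈ T.δ Φ) (hu : u ∈ T.δ x) : ∃ v ∈ T.δ (T.γ Φ), v ≤ u := by
  refine leaf_induction Φ (P := fun u => ∃ v ∈ T.δ (T.γ Φ), v ≤ u)
    (fun u hu => ⟨u, hu, le_rfl⟩) (fun x _ h => ?_) x hx u hu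
  obtain ⟨u, hu⟩ := T.δ_nonempty x
  obtain ⟨v, hv, hvu⟩ := h u hu
  exact ⟨v, hv, hvu.trans (lt_γ hu).le⟩

/-! ### Monotonicity and comparability along the upper order. -/

theorem lt_head_induction {k : ℕ} {b : T.Face k} {P : T.Face k → Prop}
    (step : ∀ Φ : T.Face (k + 1), ∀ a ∈ T.δ Φ, T.γ Φ ≤ b → (T.γ Φ < b → P (T.γ Φ)) → P a)
    {a : T.Face k} (h : a < b) : P a := by
  induction a using WellFoundedGT.induction with
  | ind a ih =>
    obtain ⟨Φ, hΦ, hle⟩ := exists_δ_of_lt h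
    exact step Φ a hΦ hle fun h' => ih _ (lt_γ hΦ) h'

theorem γ_mono {k : ℕ} {a b : T.Face (k + 1)} (h : a ≤ b) : T.γ a ≤ T.γ b := by
  rcases h.eq_or_lt with rfl | h
  · exact le_rfl
  · refine lt_head_induction (P := fun a => T.γ a ≤ T.γ b) (fun Φ a ha hle ih => ?_) h
    rcases hle.eq_or_lt with rfl | hlt
    · exact γ_le_γγ ha
    · exact (γ_le_γγ ha).trans (ih hlt)

theorem exists_δ_le {k : ℕ} {a b : T.Face (k + 1)} (h : a ≤ b) {x : T.Face k}
    (hx : x ∈ T.δ a) : ∃ y ∈ T.δ b, y ≤ x := by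
  rcases h.eq_or_lt with rfl | h
  · exact ⟨x, hx, le_rfl⟩
  · refine lt_head_induction (P := fun a => ∀ x ∈ T.δ a, ∃ y ∈ T.δ b, y ≤ x)
      (fun Φ a ha hle ih x hx => ?_) h x hx
    obtain ⟨v, hv, hvx⟩ := exists_δγ_le ha hx
    rcases hle.eq_or_lt with rfl | hlt
    · exact ⟨v, hv, hvx⟩
    · obtain ⟨y, hy, hyv⟩ := ih hlt v hv
      exact ⟨y, hy, hyv.trans hvx⟩

/-- The first faces of the two paths out of `c` share `c`, so they are comparable one dimension up.
As `γ` is monotone, the smaller of the two codomains lies below both `a` and `b` and replaces `c`.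
-/
theorem le_total_of_le {k : ℕ} {c a b : T.Face k} (ha : c ≤ a) (hb : c ≤ b) :
    a ≤ b ∨ b ≤ a := by
  induction c using WellFoundedGT.induction with
  | ind c ih =>
    rcases ha.eq_or_lt with rfl | ha
    · exact Or.inl hb
    rcases hb.eq_or_lt with rfl | hb
    · exact Or.inr ha.le
    obtain ⟨Φ, hΦ, hΦa⟩ := exists_δ_of_lt ha
    obtain ⟨Ψ, hΨ, hΨb⟩ := exists_δ_of_lt hb
    rcases comparable_of_mem_δ hΦ hΨ with h | h
    · exact ih _ (lt_γ hΦ) hΦa ((γ_mono h).trans hΨb)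
    · exact ih _ (lt_γ hΨ) ((γ_mono h.le).trans hΦa) hΨb

/-- Climbing from `j` towards `a`, the codomain stays the same as long as `j` is a root. It must
change before `a`, and where it does some `d ≤ a` has `γ(j)` in its domain; then `d` and `b` are in
a common `δ`-pencil. -/
theorem comparable_of_γ_mem_δ {k : ℕ} {j a b : T.Face (k + 1)} (h : j < a)
    (hne : T.γ j ≠ T.γ a) (hb : T.γ j ∈ T.δ b) : a ≤ b ∨ b ≤ a := by
  refine lt_head_induction (P := fun j => T.γ j ≠ T.γ a → T.γ j ∈ T.δ b → a ≤ b ∨ b ≤ a)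
    (fun Φ j hj hle ih hne hb => ?_) h hne hb
  rcases γ_eq_or_mem_δ hj with hγ | ⟨d, hd, h⟩
  · rcases hle.eq_or_lt with rfl | hlt
    · exact absurd hγ hne
    · exact ih hlt (hγ ▸ hne) (hγ ▸ hb)
  · have hda : d ≤ a := (lt_γ hd).le.trans hle
    rcases comparable_of_mem_δ h hb with h | h
    · exact le_total_of_le hda h
    · exact Or.inr (h.le.trans hda)

theorem mem_δ_or_exists_γ {k : ℕ} {j b : T.Face (k + 1)} (h : j < b) {y : T.Face k}
    (hy : y ∈ T.δ j) : y ∈ T.δ b ∨ ∃ c < b, T.γ c = y := by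
  refine lt_head_induction (P := fun j => y ∈ T.δ j → y ∈ T.δ b ∨ ∃ c < b, T.γ c = y)
    (fun Φ j hj hle ih hy => ?_) h hy
  rcases mem_δγ_or_eq_γ hj hy with hy' | ⟨c, hc, rfl⟩
  · rcases hle.eq_or_lt with rfl | hlt
    · exact Or.inl hy'
    · exact ih hlt hy'
  · exact Or.inr ⟨c, (lt_γ hc).trans_le hle, rfl⟩

/-- Since the codomain never changes, `β` is the root of each tree met on the way up, and every leaf
of a tree lies below some face in the domain of its root. -/
theorem exists_le_δ_of_γ_eq {k : ℕ} {β α : T.Face (k + 1)} (h : β ≤ α) (hγ : T.γ β = T.γ α)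
    {c : T.Face k} (hc : c ∈ T.δ α) : ∃ d ∈ T.δ β, c ≤ d := by
  rcases h.eq_or_lt with rfl | h
  · exact ⟨c, hc, le_rfl⟩
  · refine lt_head_induction (P := fun β => T.γ β = T.γ α → ∃ d ∈ T.δ β, c ≤ d)
      (fun Φ β hβ hle ih hγ => ?_) h hγ
    have hΦ : T.γ (T.γ Φ) = T.γ α :=
      le_antisymm (γ_mono hle) (hγ ▸ γ_le_γγ hβ)
    have key : ∀ e ∈ T.δ (T.γ Φ), ∃ d ∈ T.δ β, e ≤ d := by
      intro e he
      obtain ⟨x, hx, hex⟩ := exists_of_mem_δγ he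
      refine root_induction Φ (P := fun x => ∀ e ∈ T.δ x, ∃ d ∈ T.δ β, e ≤ d) ?_ ?_ x hx e hex
      · intro x hx hxγ e he
        -- A tree has only one root, as two faces of a domain with equal codomains coincide.
        obtain rfl : x = β := eq_of_γ_eq_of_mem_δ hx hβ (by rw [hxγ, hΦ, hγ])
        exact ⟨e, he, le_rfl⟩
      · intro x _ y _ hxy ih e he
        obtain ⟨d, hd, hle⟩ := ih _ hxy
        exact ⟨d, hd, (lt_γ he).le.trans hle⟩
    rcases hle.eq_or_lt with rfl | hlt
    · exact key c hc
    · obtain ⟨e, he, hce⟩ := ih hlt hΦ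
      obtain ⟨d, hd, hed⟩ := key e he
      exact ⟨d, hd, hce.trans hed⟩

/-- Each face on the path from `y` to `z` is comparable with `a`, and it cannot lie above `a`
because its codomain is still `≤ z`; so the whole path runs below `a`. -/
theorem exists_γ_eq_of_lt {k : ℕ} {a : T.Face (k + 1)} {y z : T.Face k} (hy : y ∈ T.δ a)
    (hyz : y < z) (hz : ¬ T.γ a ≤ z) : ∃ c < a, T.γ c = z := by
  have key : ∀ x, ∀ c < a, T.γ c = x → x ≤ z → ∃ c < a, T.γ c = z := by
    intro x
    induction x using WellFoundedGT.induction with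
    | ind x ih =>
      rintro c hc rfl hle
      rcases hle.eq_or_lt with h | h
      · exact ⟨c, hc, h⟩
      · obtain ⟨β, hβ, hβz⟩ := exists_δ_of_lt h
        refine ih _ (lt_γ hβ) β ?_ rfl hβz
        rcases comparable_of_γ_mem_δ hc (fun h' => hz (h' ▸ hle)) hβ with h' | h'
        · exact absurd ((γ_mono h').trans hβz) hz
        · exact lt_of_le_of_ne h' fun h' => hz (h' ▸ hβz)
  obtain ⟨β, hβ, hβz⟩ := exists_δ_of_lt hyz
  rcases comparable_of_mem_δ hy hβ with h | h
  · exact absurd ((γ_mono h).trans hβz) hz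
  · exact key _ β h rfl hβz

theorem comparable_of_mem_δ_of_lt_γ {k : ℕ} {a b : T.Face (k + 1)} {y z : T.Face k}
    (hy : y ∈ T.δ a) (hyz : y ≤ z) (hza : z < T.γ a) (hz : z ∈ T.δ b) : a ≤ b ∨ b ≤ a := by
  rcases hyz.eq_or_lt with rfl | hyz
  · exact (comparable_of_mem_δ hy hz).imp id le_of_lt
  · obtain ⟨c, hc, rfl⟩ := exists_γ_eq_of_lt hy hyz hza.not_ge
    exact comparable_of_γ_mem_δ hc hza.ne hz

variable {J : (k : ℕ) → Set (T.Face k)}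

/-! ## The equivalence relation of an ideal -/

/-- The least equivalence relation that contains `Step J k`. -/
abbrev Sim (J : (k : ℕ) → Set (T.Face k)) {k : ℕ} (x y : T.Face k) : Prop :=
  Relation.EqvGen (Step J k) x y

/-- `x` and `y` are joined by a directed chain of steps. -/
abbrev Chain (J : (k : ℕ) → Set (T.Face k)) {k : ℕ} (x y : T.Face k) : Prop :=
  Relation.ReflTransGen (Step J k) x y

theorem Sim.refl {k : ℕ} (x : T.Face k) : Sim J x x := Relation.EqvGen.refl x

theorem Sim.symm {k : ℕ} {x y : T.Face k} (h : Sim J x y) : Sim J y x :=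
  Relation.EqvGen.symm _ _ h

theorem Sim.trans {k : ℕ} {x y z : T.Face k} (h : Sim J x y) (h' : Sim J y z) : Sim J x z :=
  Relation.EqvGen.trans _ _ _ h h'

theorem Step.sim {k : ℕ} {x y : T.Face k} (h : Step J k x y) : Sim J x y :=
  Relation.EqvGen.rel _ _ h

theorem Step.lt {k : ℕ} {x y : T.Face k} (h : Step J k x y) : x < y := by
  obtain ⟨a, -, ha, rfl⟩ := h
  exact lt_γ (ha ▸ rfl)

theorem Chain.sim {k : ℕ} {x y : T.Face k} (h : Chain J x y) : Sim J x y := by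
  induction h with
  | refl => exact Sim.refl _
  | tail _ h ih => exact ih.trans h.sim

theorem Chain.le {k : ℕ} {x y : T.Face k} (h : Chain J x y) : x ≤ y := by
  induction h with
  | refl => exact le_rfl
  | tail _ h ih => exact ih.trans h.lt.le

namespace IsIdeal

variable (hJ : T.IsIdeal J)
include hJ

theorem notMem_zero (x : T.Face 0) : x ∉ J 0 := fun h => hJ.subset_unary 0 h

theorem exists_δ_eq {k : ℕ} {j : T.Face (k + 1)} (h : j ∈ J (k + 1)) : ∃ x, T.δ j = {x} :=
  Set.ncard_eq_one.1 (hJ.subset_unary _ h)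

theorem δ_eq_of_mem {k : ℕ} {j : T.Face (k + 1)} (h : j ∈ J (k + 1)) {x : T.Face k}
    (hx : x ∈ T.δ j) : T.δ j = {x} := by
  obtain ⟨y, hy⟩ := hJ.exists_δ_eq h
  rw [hy] at hx ⊢
  rw [Set.mem_singleton_iff.1 hx]

theorem step_of_mem {k : ℕ} {j : T.Face (k + 1)} (h : j ∈ J (k + 1)) {x : T.Face k}
    (hx : x ∈ T.δ j) : Step J k x (T.γ j) := ⟨j, h, hJ.δ_eq_of_mem h hx, rfl⟩

theorem notMem_of_lt {k : ℕ} {x y : T.Face k} (h : x < y) : y ∉ J k := by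
  obtain ⟨α, rfl, -⟩ := exists_γ_of_lt h
  exact hJ.γ_notMem α

theorem le_of_mem_of_δ {k : ℕ} {j a : T.Face (k + 1)} (h : j ∈ J (k + 1)) {x : T.Face k}
    (hj : x ∈ T.δ j) (ha : x ∈ T.δ a) : j ≤ a :=
  (comparable_of_mem_δ hj ha).resolve_right fun h' => hJ.notMem_of_lt h' h

theorem le_of_mem_of_γ {k : ℕ} {j a : T.Face (k + 1)} (h : j ∈ J (k + 1))
    (hj : T.γ j = T.γ a) : j ≤ a :=
  (comparable_of_γ_eq hj).resolve_right fun h' => hJ.notMem_of_lt h' h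

theorem notMem_left_of_step {k : ℕ} {x y : T.Face k} (h : Step J k x y) : x ∉ J k := by
  obtain ⟨a, ha, hx, rfl⟩ := h
  exact hJ.δ_notMem a ha x (hx ▸ rfl)

theorem notMem_right_of_step {k : ℕ} {x y : T.Face k} (h : Step J k x y) : y ∉ J k := by
  obtain ⟨a, ha, hx, rfl⟩ := h
  exact hJ.γ_notMem a

theorem notMem_iff_of_sim {k : ℕ} {x y : T.Face k} (h : Sim J x y) : x ∉ J k ↔ y ∉ J k := by
  induction h with
  | rel _ _ h => exact iff_of_true (hJ.notMem_left_of_step h) (hJ.notMem_right_of_step h)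
  | refl => exact Iff.rfl
  | symm _ _ _ ih => exact ih.symm
  | trans _ _ _ _ _ ih₁ ih₂ => exact ih₁.trans ih₂

/-- The arrow of the step is minimal, so it lies below the first face of any path leaving `a`;
compare codomains. -/
theorem le_of_step_left {k : ℕ} {a a' b : T.Face k} (h : Step J k a a') (hab : a < b) :
    a' ≤ b := by
  obtain ⟨j, hj, ha, rfl⟩ := h
  obtain ⟨α, hα, hle⟩ := exists_δ_of_lt hab
  exact (γ_mono (hJ.le_of_mem_of_δ hj (ha ▸ rfl) hα)).trans hle

/-- The arrow of the step lies below the last face of any path into `b` and has the same codomain,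
so `exists_le_δ_of_γ_eq` puts the domain of that face below `b'`. -/
theorem le_of_step_right {k : ℕ} {a b b' : T.Face k} (h : Step J k b' b) (hab : a < b) :
    a ≤ b' := by
  obtain ⟨j, hj, hb, rfl⟩ := h
  obtain ⟨α, hα, c, hc, hac⟩ := exists_γ_of_lt hab
  obtain ⟨d, hd, hcd⟩ := exists_le_δ_of_γ_eq (hJ.le_of_mem_of_γ hj hα.symm) hα.symm hc
  rw [hb] at hd
  exact hac.trans (Set.mem_singleton_iff.1 hd ▸ hcd)

theorem rightUnique_step (k : ℕ) : Relator.RightUnique (Step J k) := fun _ _ _ h h' =>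
  le_antisymm (hJ.le_of_step_left h h'.lt) (hJ.le_of_step_left h' h.lt)

theorem leftUnique_step (k : ℕ) : Relator.LeftUnique (Step J k) := fun _ _ _ h h' =>
  le_antisymm (hJ.le_of_step_right h' h.lt) (hJ.le_of_step_right h h'.lt)

theorem chain_or_chain {k : ℕ} {x y : T.Face k} (h : Sim J x y) : Chain J x y ∨ Chain J y x := by
  induction h with
  | rel _ _ h => exact Or.inl (Relation.ReflTransGen.single h)
  | refl => exact Or.inl Relation.ReflTransGen.refl
  | symm _ _ _ ih => exact ih.symm
  | trans x y z _ _ ih₁ ih₂ =>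
    rcases ih₁ with h₁ | h₁ <;> rcases ih₂ with h₂ | h₂
    · exact Or.inl (h₁.trans h₂)
    · have := Relation.ReflTransGen.total_of_right_unique (r := Function.swap (Step J k))
        (fun _ _ _ h h' => hJ.leftUnique_step k h h')
        (Relation.reflTransGen_swap.2 h₁) (Relation.reflTransGen_swap.2 h₂)
      exact this.symm.imp Relation.reflTransGen_swap.1 Relation.reflTransGen_swap.1
    · exact Relation.ReflTransGen.total_of_right_unique (hJ.rightUnique_step k) h₁ h₂
    · exact Or.inr (h₂.trans h₁)

theorem chain_of_le {k : ℕ} {x y : T.Face k} (h : Sim J x y) (hle : x ≤ y) : Chain J x y := by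
  rcases hJ.chain_or_chain h with h | h
  · exact h
  · obtain rfl := le_antisymm hle h.le
    exact Relation.ReflTransGen.refl

theorem le_total_of_sim {k : ℕ} {x y : T.Face k} (h : Sim J x y) : x ≤ y ∨ y < x := by
  rcases hJ.chain_or_chain h with h | h
  · exact Or.inl h.le
  · exact h.le.eq_or_lt.imp (fun h => h.ge) id

theorem lt_of_sim_left {k : ℕ} {a a' b : T.Face k} (h : Sim J a a') (hab : a < b)
    (hn : ¬ Sim J a b) : a' < b := by
  rcases hJ.chain_or_chain h with h | h
  · induction h with
    | refl => exact hab
    | tail h₁ h₂ ih =>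
      refine lt_of_le_of_ne (hJ.le_of_step_left h₂ (ih (Chain.sim h₁))) ?_
      rintro rfl
      exact hn h
  · exact h.le.trans_lt hab

theorem lt_of_sim_right {k : ℕ} {a b b' : T.Face k} (h : Sim J b b') (hab : a < b)
    (hn : ¬ Sim J a b) : a < b' := by
  rcases hJ.chain_or_chain h with h | h
  · exact hab.trans_le h.le
  · have h0 := h
    induction h using Relation.ReflTransGen.head_induction_on with
    | refl => exact hab
    | head h₁ h₂ ih =>
      refine lt_of_le_of_ne (hJ.le_of_step_right h₁ (ih (Chain.sim h₂).symm h₂)) ?_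
      rintro rfl
      exact hn h0.sim

theorem sim_of_le_of_le {k : ℕ} {x y z : T.Face k} (hxz : x ≤ z) (hzy : z ≤ y)
    (h : Sim J x y) : Sim J x z := by
  rcases hxz.eq_or_lt with rfl | hxz
  · exact Sim.refl _
  · by_contra hn
    exact hzy.not_gt (hJ.lt_of_sim_left h hxz hn)

theorem eq_of_sim_of_mem_δ {k : ℕ} {α : T.Face (k + 1)} {x y : T.Face k} (hx : x ∈ T.δ α)
    (hy : y ∈ T.δ α) (h : Sim J x y) : x = y :=
  (hJ.le_total_of_sim h).elim (eq_of_le_of_mem_δ hx hy)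
    fun h => absurd h (not_lt_of_mem_δ hy hx)

/-- A face whose class is a loop is unary: a second `c ∈ δ(α)` is either equivalent to `w` or
strictly below it, and `δ(α)` is an antichain. -/
theorem sim_γ_of_mem_δ {k : ℕ} {α : T.Face (k + 1)} {w c : T.Face k} (hw : w ∈ T.δ α)
    (h : Sim J w (T.γ α)) (hc : c ∈ T.δ α) : c = w := by
  by_cases h' : Sim J c (T.γ α)
  · exact hJ.eq_of_sim_of_mem_δ hc hw (h'.trans h.symm)
  · exact absurd (hJ.lt_of_sim_right h.symm (lt_γ hc) h') (not_lt_of_mem_δ hc hw)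

end IsIdeal

/-! ### Collapsed faces. -/

/-- A face is collapsed if it is in the ideal, or is a unary face whose class is a loop. -/
def Collapsed (J : (k : ℕ) → Set (T.Face k)) {k : ℕ} (x : T.Face (k + 1)) : Prop :=
  ∀ u ∈ T.δ x, Sim J u (T.γ x)

/-- Every face in the domain tree of `a` can be followed downwards through collapsed faces. -/
theorem exists_sim_leaf_or_not_collapsed {k : ℕ} {a : T.Face (k + 2)} {x : T.Face (k + 1)}
    (hx : x ∈ T.δ a) {u : T.Face k} (hu : u ∈ T.δ x) :
    (∃ v ∈ T.δ (T.γ a), Sim J v u) ∨ ∃ y ∈ T.δ a, ¬ Collapsed J y ∧ Sim J (T.γ y) u := by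
  refine leaf_induction a (P := fun u => (∃ v ∈ T.δ (T.γ a), Sim J v u) ∨
    ∃ y ∈ T.δ a, ¬ Collapsed J y ∧ Sim J (T.γ y) u) (fun u hu => Or.inl ⟨u, hu, Sim.refl _⟩)
    (fun y hy ih => ?_) x hx u hu
  by_cases hc : Collapsed J y
  · obtain ⟨w, hw⟩ := T.δ_nonempty y
    exact (ih w hw).imp (fun ⟨v, hv, h⟩ => ⟨v, hv, h.trans (hc w hw)⟩)
      fun ⟨z, hz, hzc, h⟩ => ⟨z, hz, hzc, h.trans (hc w hw)⟩
  · exact Or.inr ⟨y, hy, hc, Sim.refl _⟩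

theorem sim_γγ_or_exists_not_collapsed {k : ℕ} {a : T.Face (k + 2)} {x : T.Face (k + 1)}
    (hx : x ∈ T.δ a) : Sim J (T.γ x) (T.γ (T.γ a)) ∨
      ∃ y ∈ T.δ a, ¬ Collapsed J y ∧ ∃ u ∈ T.δ y, Sim J u (T.γ x) := by
  refine root_induction a (P := fun x => Sim J (T.γ x) (T.γ (T.γ a)) ∨
      ∃ y ∈ T.δ a, ¬ Collapsed J y ∧ ∃ u ∈ T.δ y, Sim J u (T.γ x))
    (fun _ _ h => Or.inl (h ▸ Sim.refl _)) (fun x _ y hy hxy ih => ?_) x hx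
  by_cases hc : Collapsed J y
  · refine ih.imp (fun h => (hc _ hxy).trans h) ?_
    rintro ⟨z, hz, hzc, u, hu, h⟩
    exact ⟨z, hz, hzc, u, hu, h.trans (hc _ hxy).symm⟩
  · exact Or.inr ⟨y, hy, hc, _, hxy, Sim.refl _⟩

namespace IsIdeal

variable (hJ : T.IsIdeal J)
include hJ

theorem collapsed_of_mem {k : ℕ} {x : T.Face (k + 1)} (h : x ∈ J (k + 1)) : Collapsed J x :=
  fun _ hu => (hJ.step_of_mem h hu).sim

theorem collapsed_of_sim {k : ℕ} {x : T.Face (k + 1)} {u : T.Face k} (hu : u ∈ T.δ x)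
    (h : Sim J u (T.γ x)) : Collapsed J x := fun c hc => by
  rwa [hJ.sim_γ_of_mem_δ hu h hc]

theorem notMem_of_collapsed {k : ℕ} {x : T.Face (k + 1)} (h : Collapsed J x) {u : T.Face k}
    (hu : u ∈ T.δ x) : u ∉ J k :=
  (hJ.notMem_iff_of_sim (h u hu)).2 (hJ.γ_notMem x)

/-- Domain and codomain of `x` lie between a face of `δ(g)` and `γ(g)`, and classes are convex. -/
theorem collapsed_of_le {k : ℕ} {x g : T.Face (k + 1)} (hg : Collapsed J g) (h : x ≤ g) :
    Collapsed J x := fun w hw => by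
  obtain ⟨s, hs, hsw⟩ := exists_δ_le h hw
  exact (hJ.sim_of_le_of_le hsw ((lt_γ hw).le.trans (γ_mono h)) (hg s hs)).symm.trans
    (hJ.sim_of_le_of_le (hsw.trans (lt_γ hw).le) (γ_mono h) (hg s hs))

theorem not_sim_of_not_collapsed {k : ℕ} {x : T.Face (k + 1)} (hx : ¬ Collapsed J x)
    {u : T.Face k} (hu : u ∈ T.δ x) : ¬ Sim J u (T.γ x) := fun h =>
  hx (hJ.collapsed_of_sim hu h)

/-! ### Domains contained in the ideal -/

theorem sim_γγ_of_δ_subset {k : ℕ} {a : T.Face (k + 2)} (h : T.δ a ⊆ J (k + 1))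
    {x : T.Face (k + 1)} (hx : x ∈ T.δ a) : Sim J (T.γ x) (T.γ (T.γ a)) :=
  root_induction a (P := fun x => Sim J (T.γ x) (T.γ (T.γ a))) (fun _ _ h => h ▸ Sim.refl _)
    (fun _ _ _ hy hxy ih => (hJ.step_of_mem (h hy) hxy).sim.trans ih) x hx

theorem collapsed_γ_of_δ_subset {k : ℕ} {a : T.Face (k + 2)} (h : T.δ a ⊆ J (k + 1)) :
    Collapsed J (T.γ a) := fun u hu => by
  obtain ⟨x, hx, hux⟩ := exists_of_mem_δγ hu
  exact (hJ.step_of_mem (h hx) hux).sim.trans (hJ.sim_γγ_of_δ_subset h hx)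

theorem sim_γγ_or_exists_notMem {k : ℕ} {a : T.Face (k + 2)} {x : T.Face (k + 1)}
    (hx : x ∈ T.δ a) : Sim J (T.γ x) (T.γ (T.γ a)) ∨
      ∃ y ∈ T.δ a, y ∉ J (k + 1) ∧ ∃ u ∈ T.δ y, Sim J u (T.γ x) :=
  (sim_γγ_or_exists_not_collapsed hx).imp id fun ⟨y, hy, hc, h⟩ =>
    ⟨y, hy, fun h => hc (hJ.collapsed_of_mem h), h⟩

/-- Unless the domain is contained in the ideal, its root may be taken outside of the ideal. -/
theorem exists_notMem_sim_γγ {k : ℕ} {a : T.Face (k + 2)} (h : ¬ T.δ a ⊆ J (k + 1)) :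
    ∃ x ∈ T.δ a, x ∉ J (k + 1) ∧ Sim J (T.γ x) (T.γ (T.γ a)) := by
  by_contra! hn
  have key : ∀ x ∈ T.δ a, x ∈ J (k + 1) ∧ Sim J (T.γ x) (T.γ (T.γ a)) := by
    refine root_induction a (fun x hx hxr => ?_) fun x hx y hy hxy ih => ?_
    · have hs : Sim J (T.γ x) (T.γ (T.γ a)) := hxr ▸ Sim.refl _
      exact ⟨by_contra fun h' => hn x hx h' hs, hs⟩
    · have hs := (hJ.step_of_mem ih.1 hxy).sim.trans ih.2
      exact ⟨by_contra fun h' => hn x hx h' hs, hs⟩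
  exact h fun x hx => (key x hx).1

theorem exists_notMem_δ {k : ℕ} {a : T.Face (k + 2)} (h : ¬ T.δ a ⊆ J (k + 1))
    {x : T.Face (k + 1)} (hx : x ∈ T.δ a) : ∃ y ∈ T.δ a, y ∉ J (k + 1) ∧
      (Sim J (T.γ y) (T.γ x) ∨ ∃ u ∈ T.δ y, Sim J u (T.γ x)) := by
  rcases hJ.sim_γγ_or_exists_notMem hx with h' | ⟨y, hy, hyJ, hu⟩
  · obtain ⟨y, hy, hyJ, hs⟩ := hJ.exists_notMem_sim_γγ h
    exact ⟨y, hy, hyJ, Or.inl (hs.trans h'.symm)⟩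
  · exact ⟨y, hy, hyJ, Or.inr hu⟩

/-- Unless the domain is contained in the ideal, every leaf is a leaf of a face outside of it. -/
theorem exists_notMem_sim_leaf {k : ℕ} {a : T.Face (k + 2)} (h : ¬ T.δ a ⊆ J (k + 1))
    {u : T.Face k} (hu : u ∈ T.δ (T.γ a)) :
    ∃ x ∈ T.δ a, x ∉ J (k + 1) ∧ ∃ v ∈ T.δ x, Sim J v u := by
  by_contra! hn
  obtain ⟨x₀, hx₀, hux₀⟩ := exists_of_mem_δγ hu
  have hx₀J : x₀ ∈ J (k + 1) := by_contra fun h' => hn x₀ hx₀ h' u hux₀ (Sim.refl _)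
  have hs : Sim J u (T.γ (T.γ a)) := by
    rcases hJ.sim_γγ_or_exists_notMem hx₀ with h' | ⟨y, hy, hyJ, v, hv, hs⟩
    · exact (hJ.step_of_mem hx₀J hux₀).sim.trans h'
    · exact absurd (hs.trans (hJ.step_of_mem hx₀J hux₀).sim.symm) (hn y hy hyJ v hv)
  -- The whole tree now lies in one class, so any face outside the ideal has `u`, up to equivalence,
  -- in its domain.
  have hc : Collapsed J (T.γ a) := hJ.collapsed_of_sim hu hs
  obtain ⟨x, hx, hxJ⟩ := Set.not_subset.1 h
  have hxc := hJ.collapsed_of_le hc (lt_γ hx).le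
  obtain ⟨w, hw⟩ := T.δ_nonempty x
  obtain ⟨v, hv, hvw⟩ := exists_δγ_le hx hw
  refine hn x hx hxJ w hw ?_
  obtain rfl := hJ.sim_γ_of_mem_δ hu hs hv
  exact (hJ.sim_of_le_of_le hvw ((lt_γ hw).le.trans (γ_le_γγ hx)) hs).symm

/-- A leaf `e` below `z` is strictly below `γ(z)` and inequivalent to it, so `u ∼ γ(z)` would put
the leaf `e` strictly below the leaf `u`. -/
theorem not_sim_leaf_γ {k : ℕ} {a : T.Face (k + 2)} {u : T.Face k} (hu : u ∈ T.δ (T.γ a))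
    {z : T.Face (k + 1)} (hz : z ∈ T.δ a) (hzc : ¬ Collapsed J z) : ¬ Sim J u (T.γ z) := by
  intro h
  obtain ⟨d, hd⟩ := T.δ_nonempty z
  obtain ⟨e, he, hed⟩ := exists_δγ_le hz hd
  by_cases hs : Sim J e (T.γ z)
  · exact hzc (hJ.collapsed_of_sim hd
      ((hJ.sim_of_le_of_le hed (lt_γ hd).le hs).symm.trans hs))
  · exact not_lt_of_mem_δ he hu (hJ.lt_of_sim_right h.symm (hed.trans_lt (lt_γ hd)) hs)

theorem δ_subset_δγ {k : ℕ} {a : T.Face (k + 2)} {x : T.Face (k + 1)} (hx : x ∈ T.δ a)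
    (h : T.δ x ⊆ J k) : T.δ x ⊆ T.δ (T.γ a) := fun _ hu =>
  (mem_δγ_or_eq_γ hx hu).resolve_right fun ⟨y, _, hy⟩ => hJ.γ_notMem y (hy ▸ h hu)

/-! ### Pencils -/

/-- Going backwards from `γ(b)`, each step is an ideal arrow strictly below `b`, so its domain is
either in `δ(b)` or again a codomain below `b`. Once the chain is below `δ(b)` it stays there. -/
theorem chain_γ_cases {k : ℕ} {b : T.Face (k + 1)} (hb : b ∉ J (k + 1)) {x : T.Face k}
    (h : Chain J x (T.γ b)) :
    x = T.γ b ∨ (∃ y ∈ T.δ b, x ≤ y) ∨ ∃ c < b, T.γ c = x := by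
  induction h using Relation.ReflTransGen.head_induction_on with
  | refl => exact Or.inl rfl
  | @head x' x h _ ih =>
    rcases ih with rfl | ⟨y, hy, hxy⟩ | ⟨c, hc, rfl⟩
    · obtain ⟨j, hj, hx, hγ⟩ := h
      have hlt : j < b := lt_of_le_of_ne (hJ.le_of_mem_of_γ hj hγ) fun h => hb (h ▸ hj)
      exact Or.inr ((mem_δ_or_exists_γ hlt (hx ▸ rfl : x' ∈ T.δ j)).imp
        (fun h => ⟨_, h, le_rfl⟩) id)
    · exact Or.inr (Or.inl ⟨y, hy, h.lt.le.trans hxy⟩)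
    · obtain ⟨j, hj, hx, hγ⟩ := h
      have hlt : j < b := (hJ.le_of_mem_of_γ hj hγ).trans_lt hc
      exact Or.inr ((mem_δ_or_exists_γ hlt (hx ▸ rfl : x' ∈ T.δ j)).imp
        (fun h => ⟨_, h, le_rfl⟩) id)

theorem pencil_γγ {k : ℕ} {a b : T.Face (k + 1)} (ha : a ∉ J (k + 1)) (hb : b ∉ J (k + 1))
    (h : Sim J (T.γ a) (T.γ b)) :
    (T.ltMinus (k + 1) a b ∨ T.ltMinus (k + 1) b a) ∨ (a ≤ b ∨ b ≤ a) := by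
  wlog hle : Chain J (T.γ a) (T.γ b) generalizing a b
  · exact (this hb ha h.symm ((hJ.chain_or_chain h).resolve_left hle)).imp Or.symm Or.symm
  rcases hJ.chain_γ_cases hb hle with h | ⟨y, hy, h⟩ | ⟨c, hc, h⟩
  · exact Or.inr ((comparable_of_γ_eq h).imp id le_of_lt)
  · exact Or.inl (Or.inl (ltMinus_of_le h hy))
  · rcases comparable_of_γ_eq h with h | h
    · exact Or.inr (le_total_of_le h hc.le)
    · exact Or.inr (Or.inl (h.trans hc).le)

/-- If `γ(a)` is not below `y`, then either `y ∼ γ(b)`, which reduces to `pencil_γγ`, or `γ(a)` lies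
strictly between `y` and `γ(b)` and so is the codomain of a face below `b`. -/
theorem pencil_γδ {k : ℕ} {a b : T.Face (k + 1)} (ha : a ∉ J (k + 1)) (hb : b ∉ J (k + 1))
    {y : T.Face k} (hy : y ∈ T.δ b) (h : Sim J (T.γ a) y) :
    (T.ltMinus (k + 1) a b ∨ T.ltMinus (k + 1) b a) ∨ (a ≤ b ∨ b ≤ a) := by
  rcases hJ.le_total_of_sim h with hle | hlt
  · exact Or.inl (Or.inl (ltMinus_of_le hle hy))
  by_cases hs : Sim J y (T.γ b)
  · exact hJ.pencil_γγ ha hb (h.trans hs)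
  have hlt' := hJ.lt_of_sim_left h.symm (lt_γ hy) hs
  obtain ⟨c, hc, hγ⟩ := exists_γ_eq_of_lt hy hlt hlt'.not_ge
  rcases comparable_of_γ_eq hγ with h | h
  · exact Or.inr (le_total_of_le h hc.le)
  · exact Or.inr (Or.inl (h.trans hc).le)

theorem pencil_δδ {k : ℕ} {a b : T.Face (k + 1)} (ha : a ∉ J (k + 1)) (hb : b ∉ J (k + 1))
    {y z : T.Face k} (hy : y ∈ T.δ a) (hz : z ∈ T.δ b) (h : Sim J y z) :
    (T.ltMinus (k + 1) a b ∨ T.ltMinus (k + 1) b a) ∨ (a ≤ b ∨ b ≤ a) := by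
  wlog hle : y ≤ z generalizing a b y z
  · exact (this hb ha hz hy h.symm (((hJ.le_total_of_sim h).resolve_left hle).le)).imp
      Or.symm Or.symm
  by_cases hs : Sim J y (T.γ a)
  · exact hJ.pencil_γδ ha hb hz (hs.symm.trans h)
  · exact Or.inr (comparable_of_mem_δ_of_lt_γ hy hle (hJ.lt_of_sim_left h (lt_γ hy) hs) hz)

/-- Along a chain that starts in a face `γ(x)` with `x ∈ δ(b)` and does not reach `γγ(b)`, every
face is the codomain of a face below some face in `δ(b)`. -/
theorem exists_le_of_chain {k : ℕ} {b : T.Face (k + 2)} {x : T.Face (k + 1)} (hx : x ∈ T.δ b)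
    {c : T.Face k} (h : Chain J (T.γ x) c) (hc : c ≤ T.γ (T.γ b)) :
    ∃ y ∈ T.δ b, ∃ j ≤ y, T.γ j = c := by
  induction h with
  | refl => exact ⟨x, hx, x, le_rfl, rfl⟩
  | @tail c c' _ h ih =>
    obtain ⟨y, hy, j, hjy, rfl⟩ := ih (h.lt.le.trans hc)
    have hne : T.γ j ≠ T.γ (T.γ b) := (h.lt.trans_le hc).ne
    obtain ⟨e, he, hδ, rfl⟩ := h
    by_cases hγ : T.γ j = T.γ y
    -- The chain has reached the codomain of `y`, so it passes to the parent of `y` in the tree; the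
    -- ideal arrow, being minimal, lies below that parent.
    · rcases γ_eq_or_mem_δ hy with h | ⟨z, hz, h⟩
      · exact absurd (hγ.trans h) hne
      · exact ⟨z, hz, e, hJ.le_of_mem_of_δ he (x := T.γ j) (hδ ▸ rfl) (hγ ▸ h), rfl⟩
    · have hlt : j < y := lt_of_le_of_ne hjy fun h => hγ (h ▸ rfl)
      rcases comparable_of_γ_mem_δ hlt hγ (hδ ▸ rfl : T.γ j ∈ T.δ e) with h | h
      · rcases h.eq_or_lt with h | h
        · exact ⟨y, hy, e, h.ge, rfl⟩
        · exact absurd he (hJ.notMem_of_lt h)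
      · exact ⟨y, hy, e, h, rfl⟩

/-- If `γ(a)` is below no face of `δ(b)`, the pencil lemmas place its domain and codomain between
`γ(x)` and `q`, inside one class. The ideal chain from `γ(x)` then leads to a face `z ∈ δ(b)` lying
above some `e ∈ δ(a)` and strictly below `γ(a)`, which makes `a` and `b` comparable. -/
theorem pencil_emptyDomain {k : ℕ} {a b : T.Face (k + 2)} (ha : T.δ a ⊆ J (k + 1))
    {x y : T.Face (k + 1)} (hx : x ∈ T.δ b) (hxc : ¬ Collapsed J x)
    (hxγ : Sim J (T.γ x) (T.γ (T.γ a)))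
    (hy : y ∈ T.δ b) (hyc : ¬ Collapsed J y) {q : T.Face k} (hq : q ∈ T.δ y)
    (hqγ : Sim J q (T.γ (T.γ a))) : T.ltMinus (k + 2) a b ∨ a < b := by
  have hg := hJ.collapsed_γ_of_δ_subset ha
  have hgJ := hJ.γ_notMem a
  have hxJ : x ∉ J (k + 1) := fun h => hxc (hJ.collapsed_of_mem h)
  have hyJ : y ∉ J (k + 1) := fun h => hyc (hJ.collapsed_of_mem h)
  obtain ⟨s, hs⟩ := T.δ_nonempty (T.γ a)
  have hsγ := hg s hs
  by_cases hle : ∃ z ∈ T.δ b, T.γ a ≤ z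
  · obtain ⟨z, hz, h⟩ := hle
    exact Or.inl (ltMinus_of_le h hz)
  push Not at hle
  have hcmp : ∀ z ∈ T.δ b, ¬ Collapsed J z → ¬ (T.γ a ≤ z ∨ z ≤ T.γ a) := by
    rintro z hz hzc (h | h)
    · exact hle z hz h
    · exact hzc (hJ.collapsed_of_le hg h)
  -- `γ(x) ≤ s`
  have hxs : T.γ x ≤ s := by
    rcases (hJ.pencil_γγ hgJ hxJ hxγ.symm).resolve_right (hcmp x hx hxc) with h | h
    · obtain ⟨w, hw, h⟩ := exists_le_of_ltMinus h
      exact absurd ((hJ.sim_of_le_of_le h (lt_γ hw).le hxγ.symm).symm.trans hxγ.symm)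
        (hJ.not_sim_of_not_collapsed hxc hw)
    · obtain ⟨w, hw, h⟩ := exists_le_of_ltMinus h
      rwa [hJ.sim_γ_of_mem_δ hs hsγ hw] at h
  -- `γγ(a) ≤ q`
  have hyq : T.γ (T.γ a) ≤ q := by
    rcases (hJ.pencil_γδ hgJ hyJ hq hqγ.symm).resolve_right (hcmp y hy hyc) with h | h
    · obtain ⟨w, hw, h⟩ := exists_le_of_ltMinus h
      exact ((hJ.le_total_of_sim hqγ.symm).resolve_right fun h' =>
        not_lt_of_mem_δ hq hw (h'.trans_le h))
    · obtain ⟨w, hw, h⟩ := exists_le_of_ltMinus h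
      rw [hJ.sim_γ_of_mem_δ hs hsγ hw] at h
      exact absurd (hJ.lt_of_sim_left (hqγ.trans hsγ.symm) (lt_γ hq)
        (hJ.not_sim_of_not_collapsed hyc hq)) h.not_gt
  obtain ⟨e, he, hse⟩ := exists_of_mem_δγ hs
  have hstep := hJ.step_of_mem (ha he) hse
  have hchain : Chain J (T.γ x) (T.γ e) :=
    (hJ.chain_of_le (hxγ.trans hsγ.symm) hxs).tail hstep
  have hyb : T.γ y ≤ T.γ (T.γ b) := γ_le_γγ hy
  obtain ⟨z, hz, j, hjz, hj⟩ := hJ.exists_le_of_chain hx hchain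
    ((γ_le_γγ he).trans (hyq.trans ((lt_γ hq).le.trans hyb)))
  have hez : e ≤ z := (hJ.le_of_mem_of_γ (ha he) hj.symm).trans hjz
  have hzg : z < T.γ a := lt_of_le_of_ne
    ((le_total_of_le (lt_γ he).le hez).resolve_left (hle z hz)) fun h => hle z hz h.ge
  rcases comparable_of_mem_δ_of_lt_γ he hez hzg hz with h | h
  · refine Or.inr (lt_of_le_of_ne h ?_)
    rintro rfl
    exact hxJ (ha hx)
  -- The case `b ≤ a` would put `x` below the collapsed face `γ(a)`.
  · exact absurd (hJ.collapsed_of_le hg ((lt_γ hx).le.trans (γ_mono h))) hxc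

/-- The least face `m` of the class of `x` still has an ideal arrow strictly below it, so it is a
codomain `γ(α)`. A collapsed `α` would have a smaller member of the class in its domain. -/
theorem exists_not_collapsed_sim_γ {k : ℕ} {x : T.Face (k + 1)} (hxJ : x ∉ J (k + 1))
    (hx : Collapsed J x) :
    ∃ α : T.Face (k + 2), α ∉ J (k + 2) ∧ ¬ Collapsed J α ∧ Sim J (T.γ α) x := by
  obtain ⟨m, hm, hmin⟩ := WellFounded.has_min (wellFounded_lt (α := T.Face (k + 1)))
    {y | Sim J y x} ⟨x, Sim.refl x⟩
  change Sim J m x at hm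
  replace hmin : ∀ y, Sim J y x → ¬ y < m := hmin
  obtain ⟨hγ, hδ⟩ : T.γ m = T.γ x ∧ T.δ m = T.δ x :=
    γδ_eq_of_rel (x := ⟨m, (hJ.notMem_iff_of_sim hm).2 hxJ⟩) (y := ⟨x, hxJ⟩) hm
  obtain ⟨w, hw⟩ := T.δ_nonempty m
  have hwγ : Sim J w (T.γ m) := by
    rw [hγ]
    exact hx w (hδ ▸ hw)
  -- the first arrow of the chain from `w` to `γ(m)` is below `m`
  rcases Relation.ReflTransGen.cases_head (hJ.chain_of_le hwγ (lt_γ hw).le)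
    with h | ⟨v, ⟨j, hj, hjw, -⟩, -⟩
  · exact absurd h (lt_γ hw).ne
  have hlt : j < m := lt_of_le_of_ne (hJ.le_of_mem_of_δ hj (hjw ▸ rfl) hw) fun h =>
    (hJ.notMem_iff_of_sim hm).2 hxJ (h ▸ hj)
  obtain ⟨α, rfl, -⟩ := exists_γ_of_lt hlt
  have hα : ¬ Collapsed J α := fun h => by
    obtain ⟨c, hc⟩ := T.δ_nonempty α
    exact hmin c ((h c hc).trans hm) (lt_γ hc)
  exact ⟨α, fun h => hα (hJ.collapsed_of_mem h), hα, hm⟩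

end IsIdeal

/-! ## The structure of the quotient -/

theorem cls_eq_cls_iff {k : ℕ} {x y : T.Face k} {hx : x ∉ J k} {hy : y ∉ J k} :
    cls x hx = cls y hy ↔ Sim J x y := Quotient.eq

namespace IsIdeal

variable (hJ : T.IsIdeal J)

/-- The class of a face, as a face of the quotient. -/
def faceMk {k : ℕ} (x : T.Face k) (hx : x ∉ J k) : (T.quotient J hJ).Face k := cls x hx

variable {hJ}

theorem exists_mk {k : ℕ} (c : (T.quotient J hJ).Face k) : ∃ x hx, c = hJ.faceMk x hx := by
  induction c using Quotient.inductionOn with | _ c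
  exact ⟨c.1, c.2, rfl⟩

theorem mk_eq_mk_iff {k : ℕ} {x y : T.Face k} {hx : x ∉ J k} {hy : y ∉ J k} :
    hJ.faceMk x hx = hJ.faceMk y hy ↔ Sim J x y := cls_eq_cls_iff

theorem face_mk_eq_iff {k : ℕ} {x y : T.Face k} {hx : x ∉ J k} {hy : y ∉ J k} :
    (Cell.face (hJ.faceMk x hx) : Cell (T.quotient J hJ).Face k) = Cell.face (hJ.faceMk y hy) ↔
      Sim J x y := by
  rw [Cell.face.injEq, mk_eq_mk_iff]

theorem empty_mk_eq_iff {k : ℕ} {x y : T.Face k} {hx : x ∉ J k} {hy : y ∉ J k} :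
    (Cell.empty (hJ.faceMk x hx) : Cell (T.quotient J hJ).Face (k + 1)) = Cell.empty (hJ.faceMk y hy) ↔
      Sim J x y := by
  rw [Cell.empty.injEq, mk_eq_mk_iff]

theorem cod_mk {k : ℕ} (a : T.Face (k + 1)) (ha : a ∉ J (k + 1)) :
    (T.quotient J hJ).cod (hJ.faceMk a ha) = hJ.faceMk (T.γ a) (hJ.γ_notMem a) := rfl

theorem lt_mk {k : ℕ} {a b : T.Face (k + 1)} {ha : a ∉ J (k + 1)} {hb : b ∉ J (k + 1)} :
    (T.quotient J hJ).lt (k + 1) (hJ.faceMk a ha) (hJ.faceMk b hb) ↔ T.ltMinus (k + 1) a b := Iff.rfl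

theorem dom_mk_of_subset {k : ℕ} {a : T.Face (k + 2)} (ha : a ∉ J (k + 2))
    (h : T.δ a ⊆ J (k + 1)) : (T.quotient J hJ).dom (hJ.faceMk a ha) =
      {Cell.empty (hJ.faceMk (T.γ (T.γ a)) (hJ.γ_notMem _))} := if_pos h

theorem dom_mk_of_not_subset {k : ℕ} {a : T.Face (k + 2)} (ha : a ∉ J (k + 2))
    (h : ¬ T.δ a ⊆ J (k + 1)) : (T.quotient J hJ).dom (hJ.faceMk a ha) =
      {c | ∃ x ∈ T.δ a, ∃ hx : x ∉ J (k + 1), c = Cell.face (hJ.faceMk x hx)} := if_neg h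

theorem face_mem_dom_mk {k : ℕ} {a : T.Face (k + 1)} {ha : a ∉ J (k + 1)} {u : T.Face k}
    {hu : u ∉ J k} : Cell.face (hJ.faceMk u hu) ∈ (T.quotient J hJ).dom (hJ.faceMk a ha) ↔
      ∃ x ∈ T.δ a, Sim J x u := by
  have key : Cell.face (hJ.faceMk u hu) ∈ {c | ∃ x ∈ T.δ a, ∃ hx : x ∉ J k,
      c = (Cell.face (hJ.faceMk x hx) : Cell (T.quotient J hJ).Face k)} ↔ ∃ x ∈ T.δ a, Sim J x u := by
    constructor
    · rintro ⟨x, hx, hxJ, h⟩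
      exact ⟨x, hx, (face_mk_eq_iff.1 h).symm⟩
    · rintro ⟨x, hx, h⟩
      exact ⟨x, hx, (hJ.notMem_iff_of_sim h).2 hu, face_mk_eq_iff.2 h.symm⟩
  cases k with
  | zero => exact key
  | succ k =>
    by_cases h : T.δ a ⊆ J (k + 1)
    · rw [dom_mk_of_subset ha h]
      constructor
      · intro h
        cases h
      · rintro ⟨x, hx, h'⟩
        exact absurd (h hx) ((hJ.notMem_iff_of_sim h').2 hu)
    · rw [dom_mk_of_not_subset ha h]
      exact key

theorem empty_mem_dom_mk {k : ℕ} {a : T.Face (k + 2)} {ha : a ∉ J (k + 2)} {u : T.Face k}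
    {hu : u ∉ J k} : Cell.empty (hJ.faceMk u hu) ∈ (T.quotient J hJ).dom (hJ.faceMk a ha) ↔
      T.δ a ⊆ J (k + 1) ∧ Sim J u (T.γ (T.γ a)) := by
  by_cases h : T.δ a ⊆ J (k + 1)
  · rw [dom_mk_of_subset ha h, Set.mem_singleton_iff, empty_mk_eq_iff]
    exact (and_iff_right h).symm
  · rw [dom_mk_of_not_subset ha h]
    refine iff_of_false ?_ fun h' => h h'.1
    rintro ⟨x, hx, hxJ, h⟩
    cases h

theorem exists_of_face_mem_dom {k : ℕ} {a : T.Face (k + 1)} {ha : a ∉ J (k + 1)}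
    {c : (T.quotient J hJ).Face k} (h : Cell.face c ∈ (T.quotient J hJ).dom (hJ.faceMk a ha)) :
    ∃ x ∈ T.δ a, ∃ hx, c = hJ.faceMk x hx := by
  obtain ⟨u, hu, rfl⟩ := exists_mk c
  obtain ⟨x, hx, h⟩ := face_mem_dom_mk.1 h
  exact ⟨x, hx, (hJ.notMem_iff_of_sim h).2 hu, mk_eq_mk_iff.2 h.symm⟩

theorem mk_mem_loops {k : ℕ} {a : T.Face (k + 1)} {ha : a ∉ J (k + 1)} :
    hJ.faceMk a ha ∈ (T.quotient J hJ).loops (k + 1) ↔ Collapsed J a := by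
  constructor
  · intro h
    have h' : Cell.face (hJ.faceMk (T.γ a) (hJ.γ_notMem a)) ∈ (T.quotient J hJ).dom (hJ.faceMk a ha) :=
      (show (T.quotient J hJ).dom (hJ.faceMk a ha) = {_} from h) ▸ rfl
    obtain ⟨u, hu, h⟩ := face_mem_dom_mk.1 h'
    exact hJ.collapsed_of_sim hu h
  · intro h
    obtain ⟨w, hw⟩ := T.δ_nonempty a
    have hwJ := hJ.notMem_of_collapsed h hw
    have h1 : Cell.face (hJ.faceMk (T.γ a) (hJ.γ_notMem a)) ∈ (T.quotient J hJ).dom (hJ.faceMk a ha) :=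
      face_mem_dom_mk.2 ⟨w, hw, h w hw⟩
    refine Set.Subset.antisymm (fun c hc => ?_) (Set.singleton_subset_iff.2 h1)
    cases c with
    | face c =>
      obtain ⟨x, hx, hxJ, rfl⟩ := exists_of_face_mem_dom hc
      exact face_mk_eq_iff.2 (h x hx)
    | empty c =>
      obtain ⟨x, hx, rfl⟩ := exists_mk c
      exact absurd ((empty_mem_dom_mk.1 hc).1 hw) hwJ

theorem mk_mem_emptyDomain {k : ℕ} {a : T.Face (k + 2)} {ha : a ∉ J (k + 2)}
    (h : hJ.faceMk a ha ∈ (T.quotient J hJ).emptyDomain (k + 2)) : T.δ a ⊆ J (k + 1) := by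
  obtain ⟨_, ⟨c, rfl⟩, h⟩ := h
  obtain ⟨x, hx, rfl⟩ := exists_mk c
  have h' : Cell.empty (hJ.faceMk x hx) ∈ (T.quotient J hJ).dom (hJ.faceMk a ha) := h ▸ rfl
  exact (empty_mem_dom_mk.1 h').1

theorem mem_domNonloop_mk {k : ℕ} {a : T.Face (k + 2)} {ha : a ∉ J (k + 2)}
    {c : Cell (T.quotient J hJ).Face (k + 1)} :
    c ∈ (T.quotient J hJ).domNonloop (hJ.faceMk a ha) ↔
      ∃ x ∈ T.δ a, ¬ Collapsed J x ∧ ∃ hx, c = Cell.face (hJ.faceMk x hx) := by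
  constructor
  · rintro ⟨c, hc, hd, rfl⟩
    obtain ⟨x, hx, hxJ, rfl⟩ := exists_of_face_mem_dom hd
    exact ⟨x, hx, fun h => hc (mk_mem_loops.2 h), hxJ, rfl⟩
  · rintro ⟨x, hx, hc, hxJ, rfl⟩
    exact ⟨_, fun h => hc (mk_mem_loops.1 h), face_mem_dom_mk.2 ⟨x, hx, Sim.refl _⟩, rfl⟩

theorem face_mem_γSet_domNonloop {k : ℕ} {a : T.Face (k + 2)} {ha : a ∉ J (k + 2)}
    {u : T.Face k} {hu : u ∉ J k} : Cell.face (hJ.faceMk u hu) ∈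
      (T.quotient J hJ).γSet ((T.quotient J hJ).domNonloop (hJ.faceMk a ha)) ↔
      ∃ x ∈ T.δ a, ¬ Collapsed J x ∧ Sim J u (T.γ x) := by
  constructor
  · rintro ⟨_, hc, h⟩
    obtain ⟨x, hx, hxc, hxJ, rfl⟩ := mem_domNonloop_mk.1 hc
    exact ⟨x, hx, hxc, face_mk_eq_iff.1 h⟩
  · rintro ⟨x, hx, hc, h⟩
    exact ⟨_, mem_domNonloop_mk.2 ⟨x, hx, hc, fun h => hc (hJ.collapsed_of_mem h), rfl⟩,
      face_mk_eq_iff.2 h⟩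

theorem face_mem_δSet_domNonloop {k : ℕ} {a : T.Face (k + 2)} {ha : a ∉ J (k + 2)}
    {u : T.Face k} {hu : u ∉ J k} : Cell.face (hJ.faceMk u hu) ∈
      (T.quotient J hJ).δSet ((T.quotient J hJ).domNonloop (hJ.faceMk a ha)) ↔
      ∃ x ∈ T.δ a, ¬ Collapsed J x ∧ ∃ v ∈ T.δ x, Sim J v u := by
  constructor
  · rintro ⟨_, hc, h⟩
    obtain ⟨x, hx, hxc, hxJ, rfl⟩ := mem_domNonloop_mk.1 hc
    exact ⟨x, hx, hxc, face_mem_dom_mk.1 h⟩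
  · rintro ⟨x, hx, hc, h⟩
    exact ⟨_, mem_domNonloop_mk.2 ⟨x, hx, hc, fun h => hc (hJ.collapsed_of_mem h), rfl⟩,
      face_mem_dom_mk.2 h⟩

theorem empty_notMem_γSet {k : ℕ} {A : Set (Cell (T.quotient J hJ).Face (k + 2))}
    {c : (T.quotient J hJ).Face k} : Cell.empty c ∉ (T.quotient J hJ).γSet A := by
  rintro ⟨_, _, h⟩
  cases h

/-- On a path in `T`, collapsed faces do not change the class and the others are edges of the
quotient. Conversely, a quotient edge joins inequivalent faces, so its strict inequality holds for
all representatives. -/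
theorem ltPlus_mk {k : ℕ} {a b : T.Face k} {ha : a ∉ J k} {hb : b ∉ J k} :
    (T.quotient J hJ).ltPlus k (hJ.faceMk a ha) (hJ.faceMk b hb) ↔ a < b ∧ ¬ Sim J a b := by
  have edge : ∀ {a b : T.Face k} {ha : a ∉ J k} {hb : b ∉ J k},
      (∃ α : (T.quotient J hJ).Face (k + 1), α ∉ (T.quotient J hJ).loops (k + 1) ∧
        Cell.face (hJ.faceMk a ha) ∈ (T.quotient J hJ).dom α ∧
        (T.quotient J hJ).cod α = hJ.faceMk b hb) → a < b ∧ ¬ Sim J a b := by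
    rintro a b ha hb ⟨α, hα, hd, hc⟩
    obtain ⟨α, hαJ, rfl⟩ := exists_mk α
    rw [mk_mem_loops] at hα
    obtain ⟨x, hx, hxa⟩ := face_mem_dom_mk.1 hd
    have hγ : Sim J (T.γ α) b := mk_eq_mk_iff.1 hc
    have hn := hJ.not_sim_of_not_collapsed hα hx
    have h1 := hJ.lt_of_sim_left hxa (lt_γ hx) hn
    have hn' : ¬ Sim J a (T.γ α) := fun h => hn (hxa.trans h)
    exact ⟨hJ.lt_of_sim_right hγ h1 hn', fun h => hn' (h.trans hγ.symm)⟩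
  constructor
  · intro h
    generalize hB : hJ.faceMk b hb = B at h
    induction h generalizing b with
    | single h =>
      subst hB
      exact edge h
    | @tail c d _ h ih =>
      subst hB
      obtain ⟨c, hc, rfl⟩ := exists_mk c
      obtain ⟨h1, h2⟩ := ih rfl
      obtain ⟨h3, h4⟩ := edge h
      exact ⟨h1.trans h3, fun h => (hJ.lt_of_sim_left h h1 h2).not_gt h3⟩
  · rintro ⟨hab, hn⟩
    have key : ∀ a, a < b → ∀ ha : a ∉ J k,
        Sim J a b ∨ (T.quotient J hJ).ltPlus k (hJ.faceMk a ha) (hJ.faceMk b hb) := by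
      intro a
      induction a using WellFoundedGT.induction with
      | ind a ih =>
        intro hab ha
        obtain ⟨α, hα, hle⟩ := exists_δ_of_lt hab
        have ih' : Sim J (T.γ α) b ∨
            (T.quotient J hJ).ltPlus k (hJ.faceMk (T.γ α) (hJ.γ_notMem α)) (hJ.faceMk b hb) := by
          rcases hle.eq_or_lt with h | h
          · exact Or.inl (h ▸ Sim.refl _)
          · exact ih _ (lt_γ hα) h _
        by_cases hc : Collapsed J α
        · have hs := hc a hα
          refine ih'.imp hs.trans fun h => ?_
          rwa [mk_eq_mk_iff.2 hs]
        · refine Or.inr ?_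
          have hstep : ∃ β : (T.quotient J hJ).Face (k + 1),
              β ∉ (T.quotient J hJ).loops (k + 1) ∧
              Cell.face (hJ.faceMk a ha) ∈ (T.quotient J hJ).dom β ∧
              (T.quotient J hJ).cod β = hJ.faceMk (T.γ α) (hJ.γ_notMem α) :=
            ⟨hJ.faceMk α fun h => hc (hJ.collapsed_of_mem h), fun h => hc (mk_mem_loops.1 h),
              face_mem_dom_mk.2 ⟨a, hα, Sim.refl _⟩, rfl⟩
          rcases ih' with h | h
          · rw [(mk_eq_mk_iff (hy := hb)).2 h] at hstep
            exact Relation.TransGen.single hstep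
          · exact Relation.TransGen.head hstep h
    exact (key a hab ha).resolve_left hn

theorem perpPlus_mk_of_comparable {k : ℕ} {a b : T.Face k} {ha : a ∉ J k} {hb : b ∉ J k}
    (h : a ≤ b ∨ b ≤ a) (hn : ¬ Sim J a b) :
    (T.quotient J hJ).PerpPlus (hJ.faceMk a ha) (hJ.faceMk b hb) := by
  have hne : a ≠ b := fun h => hn (h ▸ Sim.refl _)
  refine h.imp (fun h => ltPlus_mk.2 ⟨lt_of_le_of_ne h hne, hn⟩)
    fun h => ltPlus_mk.2 ⟨lt_of_le_of_ne h hne.symm, fun h => hn h.symm⟩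

theorem ltPlus_or_of_perpPlus_mk {k : ℕ} {a b : T.Face k} {ha : a ∉ J k} {hb : b ∉ J k}
    (h : (T.quotient J hJ).PerpPlus (hJ.faceMk a ha) (hJ.faceMk b hb)) : a < b ∨ b < a :=
  h.imp (fun h => (ltPlus_mk.1 h).1) fun h => (ltPlus_mk.1 h).1

/-! ### The axioms -/

theorem quotient_γ_globularity {k : ℕ} (a : (T.quotient J hJ).Face (k + 2)) :
    ({Cell.face ((T.quotient J hJ).cod ((T.quotient J hJ).cod a))} :
      Set (Cell (T.quotient J hJ).Face k)) =
      (T.quotient J hJ).γSet ((T.quotient J hJ).dom a) \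
        (T.quotient J hJ).δSet ((T.quotient J hJ).domNonloop a) := by
  obtain ⟨a, ha, rfl⟩ := exists_mk a
  rw [cod_mk, cod_mk]
  have hnot : Cell.face (hJ.faceMk (T.γ (T.γ a)) (hJ.γ_notMem _)) ∉
      (T.quotient J hJ).δSet ((T.quotient J hJ).domNonloop (hJ.faceMk a ha)) := by
    rw [face_mem_δSet_domNonloop]
    rintro ⟨x, hx, hc, v, hv, h⟩
    exact (hJ.lt_of_sim_left h (lt_γ hv) (hJ.not_sim_of_not_collapsed hc hv)).not_ge (γ_le_γγ hx)
  by_cases hsub : T.δ a ⊆ J (k + 1)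
  · rw [dom_mk_of_subset ha hsub]
    have h1 : (T.quotient J hJ).γSet {Cell.empty (hJ.faceMk (T.γ (T.γ a)) (hJ.γ_notMem _))} =
        {Cell.face (hJ.faceMk (T.γ (T.γ a)) (hJ.γ_notMem _))} := by
      ext c
      constructor
      · rintro ⟨_, rfl, rfl⟩
        rfl
      · rintro rfl
        exact ⟨_, rfl, rfl⟩
    rw [h1]
    refine Set.Subset.antisymm (Set.singleton_subset_iff.2 ⟨rfl, hnot⟩) Set.sdiff_subset
  · rw [dom_mk_of_not_subset ha hsub]
    refine Set.Subset.antisymm (Set.singleton_subset_iff.2 ⟨?_, hnot⟩) ?_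
    · obtain ⟨x, hx, hxJ, h⟩ := hJ.exists_notMem_sim_γγ hsub
      exact ⟨_, ⟨x, hx, hxJ, rfl⟩, face_mk_eq_iff.2 h.symm⟩
    · rintro _ ⟨⟨_, ⟨x, hx, hxJ, rfl⟩, rfl⟩, hn⟩
      change Cell.face (hJ.faceMk (T.γ x) (hJ.γ_notMem x)) ∉ _ at hn
      refine face_mk_eq_iff.2 ((sim_γγ_or_exists_not_collapsed hx).resolve_right ?_)
      rintro ⟨y, hy, hc, h⟩
      exact hn (face_mem_δSet_domNonloop.2 ⟨y, hy, hc, h⟩)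

/-- The absorbing set `1_θ` depends only on the faces of a set, so it is the same on both sides. -/
theorem oneEq_of_face_iff_of_empty_imp {k : ℕ} {S : Hypergraph.{u}}
    {A B : Set (Cell S.Face (k + 1))}
    (hface : ∀ x, Cell.face x ∈ A ↔ Cell.face x ∈ B)
    (hA : ∀ x, Cell.empty x ∈ A → Cell.empty x ∈ B ∪ S.oneθ B)
    (hB : ∀ x, Cell.empty x ∈ B → Cell.empty x ∈ A ∪ S.oneθ A) : S.OneEq A B := by
  have hθ : S.oneθ A = S.oneθ B := by
    ext c
    exact exists_congr fun x => and_congr_left' (hface x)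
  change A ∪ S.oneθ A = B ∪ S.oneθ B
  refine Set.Subset.antisymm (Set.union_subset (fun c hc => ?_) (hθ ▸ Set.subset_union_right))
    (Set.union_subset (fun c hc => ?_) (hθ ▸ Set.subset_union_right))
  · cases c with
    | face x => exact Or.inl ((hface x).1 hc)
    | empty x => exact hA x hc
  · cases c with
    | face x => exact Or.inl ((hface x).2 hc)
    | empty x => exact hB x hc

theorem face_mem_θ_mk {k : ℕ} {a : T.Face (k + 1)} {ha : a ∉ J (k + 1)} {u : T.Face k}
    {hu : u ∉ J k} : Cell.face (hJ.faceMk u hu) ∈ (T.quotient J hJ).θ (hJ.faceMk a ha) ↔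
      (∃ x ∈ T.δ a, Sim J x u) ∨ Sim J (T.γ a) u := by
  refine or_congr face_mem_dom_mk ?_
  exact face_mk_eq_iff.trans ⟨Sim.symm, Sim.symm⟩

theorem face_mem_δSet_dom {k : ℕ} {a : T.Face (k + 2)} {ha : a ∉ J (k + 2)} {u : T.Face k}
    {hu : u ∉ J k} : Cell.face (hJ.faceMk u hu) ∈
      (T.quotient J hJ).δSet ((T.quotient J hJ).dom (hJ.faceMk a ha)) ↔
      (∃ x ∈ T.δ a, x ∉ J (k + 1) ∧ ∃ v ∈ T.δ x, Sim J v u) ∨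
        (T.δ a ⊆ J (k + 1) ∧ Sim J u (T.γ (T.γ a))) := by
  constructor
  · rintro ⟨c, hc, hu'⟩
    cases c with
    | face c =>
      obtain ⟨x, hx, hxJ, rfl⟩ := exists_of_face_mem_dom hc
      exact Or.inl ⟨x, hx, hxJ, face_mem_dom_mk.1 hu'⟩
    | empty c =>
      obtain ⟨x, hx, rfl⟩ := exists_mk c
      obtain ⟨h, hs⟩ := empty_mem_dom_mk.1 hc
      exact Or.inr ⟨h, (face_mk_eq_iff.1 hu').trans hs⟩
  · rintro (⟨x, hx, hxJ, h⟩ | ⟨h, hs⟩)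
    · exact ⟨Cell.face (hJ.faceMk x hxJ), face_mem_dom_mk.2 ⟨x, hx, Sim.refl _⟩,
        face_mem_dom_mk.2 h⟩
    · exact ⟨Cell.empty (hJ.faceMk u hu), empty_mem_dom_mk.2 ⟨h, hs⟩, rfl⟩

theorem empty_mem_δSet_dom {k : ℕ} {a : T.Face (k + 3)} {ha : a ∉ J (k + 3)} {u : T.Face k}
    {hu : u ∉ J k} : Cell.empty (hJ.faceMk u hu) ∈
      (T.quotient J hJ).δSet ((T.quotient J hJ).dom (hJ.faceMk a ha)) ↔
      ∃ x ∈ T.δ a, x ∉ J (k + 2) ∧ T.δ x ⊆ J (k + 1) ∧ Sim J u (T.γ (T.γ x)) := by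
  constructor
  · rintro ⟨c, hc, hu'⟩
    cases c with
    | face c =>
      obtain ⟨x, hx, hxJ, rfl⟩ := exists_of_face_mem_dom hc
      exact ⟨x, hx, hxJ, empty_mem_dom_mk.1 hu'⟩
    | empty c => cases hu'
  · rintro ⟨x, hx, hxJ, h⟩
    exact ⟨Cell.face (hJ.faceMk x hxJ), face_mem_dom_mk.2 ⟨x, hx, Sim.refl _⟩,
      empty_mem_dom_mk.2 h⟩

theorem face_mem_dom_cod_iff {k : ℕ} (a : (T.quotient J hJ).Face (k + 2))
    (u : (T.quotient J hJ).Face k) :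
    Cell.face u ∈ (T.quotient J hJ).dom ((T.quotient J hJ).cod a) ↔
      Cell.face u ∈ (T.quotient J hJ).δSet ((T.quotient J hJ).dom a) \
        (T.quotient J hJ).γSet ((T.quotient J hJ).domNonloop a) := by
  obtain ⟨a, ha, rfl⟩ := exists_mk a
  obtain ⟨u, hu, rfl⟩ := exists_mk u
  rw [cod_mk, face_mem_dom_mk, Set.mem_sdiff, face_mem_δSet_dom, face_mem_γSet_domNonloop]
  constructor
  · rintro ⟨v, hv, h⟩
    refine ⟨?_, fun ⟨x, hx, hc, hs⟩ => hJ.not_sim_leaf_γ hv hx hc (h.trans hs)⟩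
    by_cases hsub : T.δ a ⊆ J (k + 1)
    · exact Or.inr ⟨hsub, h.symm.trans (hJ.collapsed_γ_of_δ_subset hsub v hv)⟩
    · obtain ⟨x, hx, hxJ, w, hw, hs⟩ := hJ.exists_notMem_sim_leaf hsub hv
      exact Or.inl ⟨x, hx, hxJ, w, hw, hs.trans h⟩
  · rintro ⟨⟨x, hx, -, v, hv, h⟩ | ⟨hsub, h⟩, hn⟩
    · rcases exists_sim_leaf_or_not_collapsed (J := J) hx hv with ⟨w, hw, hs⟩ | ⟨y, hy, hc, hs⟩
      · exact ⟨w, hw, hs.trans h⟩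
      · exact absurd ⟨y, hy, hc, (hs.trans h).symm⟩ hn
    · obtain ⟨s, hs⟩ := T.δ_nonempty (T.γ a)
      exact ⟨s, hs, (hJ.collapsed_γ_of_δ_subset hsub s hs).trans h.symm⟩

/-- If the leaves of the domain of `a` are in the ideal, then so is the whole domain of some face
in `δ(a)`. -/
theorem exists_δ_subset {k : ℕ} {a : T.Face (k + 2)} (h : T.δ (T.γ a) ⊆ J k) :
    ∃ x ∈ T.δ a, T.δ x ⊆ J k := by
  by_contra! hn
  obtain ⟨r, hr⟩ := T.δ_nonempty a
  -- The induction step is vacuous: by assumption no domain of a face in `δ(a)` is contained in the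
  -- ideal.
  exact hn r hr (leaf_induction a (P := fun u => u ∈ J k) (fun u hu => h hu)
    (fun x hx hu => absurd (fun u h => hu u h) (hn x hx)) r hr)

theorem exists_mem_δγ_sim_γγ (hJ : T.IsIdeal J) {k : ℕ} {a : T.Face (k + 3)} {x : T.Face (k + 2)}
    (hx : x ∈ T.δ a) (h : T.δ x ⊆ J (k + 1)) :
    ∃ u ∈ T.δ (T.γ a), u ∈ T.δ x ∧ Sim J (T.γ u) (T.γ (T.γ x)) := by
  obtain ⟨u, hu⟩ := T.δ_nonempty x
  exact ⟨u, hJ.δ_subset_δγ hx h hu, hu, hJ.sim_γγ_of_δ_subset h hu⟩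

/-- Only the empty faces need `≡₁`. If `δ(x) ⊆ J` then `δ(x)` consists of leaves, ideal members not
being codomains, so `1_{[γγ(x)]}` arises from an ideal leaf `v` with `γ(v) ∼ γγ(x)`. It is the
domain of `[γ(a)]` if all leaves are in the ideal; otherwise it is absorbed by a leaf outside. -/
theorem quotient_δ_globularity {k : ℕ} (a : (T.quotient J hJ).Face (k + 2)) :
    (T.quotient J hJ).OneEq ((T.quotient J hJ).dom ((T.quotient J hJ).cod a))
      ((T.quotient J hJ).δSet ((T.quotient J hJ).dom a) \
        (T.quotient J hJ).γSet ((T.quotient J hJ).domNonloop a)) := by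
  cases k with
  | zero =>
    change _ = _
    ext c
    cases c with
    | face u => exact face_mem_dom_cod_iff a u
  | succ k =>
    refine oneEq_of_face_iff_of_empty_imp (face_mem_dom_cod_iff a) ?_ ?_
    · intro u hu
      obtain ⟨a, ha, rfl⟩ := exists_mk a
      obtain ⟨u, huJ, rfl⟩ := exists_mk u
      rw [cod_mk, empty_mem_dom_mk] at hu
      obtain ⟨hsub, hs⟩ := hu
      obtain ⟨x, hx, hxsub⟩ := exists_δ_subset hsub
      obtain ⟨v, hv, hvx, hvs⟩ := hJ.exists_mem_δγ_sim_γγ hx hxsub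
      have hxJ : x ∉ J (k + 2) := fun h => hJ.δ_notMem x h v hvx (hxsub hvx)
      exact Or.inl ⟨empty_mem_δSet_dom.2 ⟨x, hx, hxJ, hxsub,
        (hs.trans (hJ.sim_γγ_of_δ_subset hsub hv).symm).trans hvs⟩, empty_notMem_γSet⟩
    · rintro u ⟨hu, -⟩
      obtain ⟨a, ha, rfl⟩ := exists_mk a
      obtain ⟨u, huJ, rfl⟩ := exists_mk u
      obtain ⟨x, hx, hxJ, hxsub, hs⟩ := empty_mem_δSet_dom.1 hu
      obtain ⟨v, hv, hvx, hvs⟩ := hJ.exists_mem_δγ_sim_γγ hx hxsub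
      rw [cod_mk]
      by_cases hsub : T.δ (T.γ a) ⊆ J (k + 1)
      · exact Or.inl (empty_mem_dom_mk.2 ⟨hsub,
          (hs.trans hvs.symm).trans (hJ.sim_γγ_of_δ_subset hsub hv)⟩)
      · obtain ⟨y, hy, hyJ, h⟩ := hJ.exists_notMem_δ hsub hv
        have hvu : Sim J (T.γ v) u := hvs.trans hs.symm
        exact Or.inr ⟨hJ.faceMk y hyJ, face_mem_dom_mk.2 ⟨y, hy, Sim.refl _⟩, hJ.faceMk u huJ,
          face_mem_θ_mk.2 (h.symm.imp (fun ⟨w, hw, h⟩ => ⟨w, hw, h.trans hvu⟩) fun h => h.trans hvu),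
          rfl⟩

/-! ### The lower order of the quotient. -/

theorem ltMinus_mk_of_ltMinus {k : ℕ} {a b : T.Face (k + 1)} {ha : a ∉ J (k + 1)}
    {hb : b ∉ J (k + 1)} (h : T.ltMinus (k + 1) a b) :
    (T.quotient J hJ).ltMinus (k + 1) (hJ.faceMk a ha) (hJ.faceMk b hb) := by
  have key : ∀ u ∈ T.δ b, ∀ a ha, Sim J (T.γ a) u →
      (T.quotient J hJ).ltMinus (k + 1) (hJ.faceMk a ha) (hJ.faceMk b hb) := fun u hu a ha h =>
    Relation.TransGen.single (face_mem_dom_mk.2 ⟨u, hu, h.symm⟩)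
  have key' : ∃ u ∈ T.δ b, Sim J (T.γ a) u ∨ ∃ c hc, (∃ v ∈ T.δ c, Sim J v (T.γ a)) ∧
      (T.quotient J hJ).ltMinus (k + 1) (hJ.faceMk c hc) (hJ.faceMk b hb) := by
    -- Intermediate faces of the path may lie in the ideal. They are skipped, since their domain and
    -- codomain are equivalent, and `c` records the first face outside it.
    clear ha
    induction h using Relation.TransGen.head_induction_on with
    | single h => exact ⟨_, h, Or.inl (Sim.refl _)⟩
    | @head a c hac _ ih =>
      obtain ⟨u, hu, ih⟩ := ih
      refine ⟨u, hu, ?_⟩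
      by_cases hc : c ∈ J (k + 1)
      · have hs := (hJ.step_of_mem hc hac).sim
        exact ih.imp hs.trans fun ⟨d, hd, ⟨v, hv, h⟩, h'⟩ => ⟨d, hd, ⟨v, hv, h.trans hs.symm⟩, h'⟩
      · refine Or.inr ⟨c, hc, ⟨_, hac, Sim.refl _⟩, ?_⟩
        rcases ih with h | ⟨d, hd, ⟨v, hv, h⟩, h'⟩
        · exact key u hu c hc h
        · exact Relation.TransGen.head (face_mem_dom_mk.2 ⟨v, hv, h⟩) h'
  obtain ⟨u, hu, h | ⟨d, hd, ⟨v, hv, h⟩, h'⟩⟩ := key'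
  · exact key u hu a ha h
  · exact Relation.TransGen.head (face_mem_dom_mk.2 ⟨v, hv, h⟩) h'

/-- The alternative `γ(a) ∼ y` means that `[a]` and `[b]` share a face. When `θ[a]` and `θ[b]` are
disjoint only `γ(a) < y` remains, which gives `a <^- b`. -/
theorem sim_or_lt_of_ltMinus_mk {k : ℕ} {a b : T.Face (k + 1)} {ha : a ∉ J (k + 1)}
    {hb : b ∉ J (k + 1)}
    (h : (T.quotient J hJ).ltMinus (k + 1) (hJ.faceMk a ha) (hJ.faceMk b hb)) :
    ∃ y ∈ T.δ b, Sim J (T.γ a) y ∨ T.γ a < y := by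
  generalize hB : hJ.faceMk b hb = B at h
  induction h generalizing b with
  | single h =>
    subst hB
    obtain ⟨x, hx, h⟩ := face_mem_dom_mk.1 h
    exact ⟨x, hx, Or.inl h.symm⟩
  | @tail c d _ h ih =>
    subst hB
    obtain ⟨c, hc, rfl⟩ := exists_mk c
    obtain ⟨y, hy, ih⟩ := ih rfl
    obtain ⟨x, hx, h⟩ := face_mem_dom_mk.1 h
    refine ⟨x, hx, ?_⟩
    have h1 : Sim J (T.γ a) (T.γ c) ∨ T.γ a < T.γ c := by
      rcases ih with ih | ih
      · by_cases hs : Sim J y (T.γ c)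
        · exact Or.inl (ih.trans hs)
        · exact Or.inr (hJ.lt_of_sim_left ih.symm (lt_γ hy) hs)
      · exact Or.inr (ih.trans (lt_γ hy))
    rcases h1 with h1 | h1
    · exact Or.inl (h1.trans h.symm)
    · by_cases hs : Sim J (T.γ a) (T.γ c)
      · exact Or.inl (hs.trans h.symm)
      · exact Or.inr (hJ.lt_of_sim_right h.symm h1 hs)

theorem quotient_isOrderedFaceStructure : (T.quotient J hJ).IsOrderedFaceStructure where
  nonempty := T.nonempty.map fun x => hJ.faceMk x (hJ.notMem_zero x)
  γ_globularity := quotient_γ_globularity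
  δ_globularity := quotient_δ_globularity
  δ_empty _ := rfl
  γ_empty _ := rfl
  local_discreteness a x y hx hy h := by
    obtain ⟨a, ha, rfl⟩ := exists_mk a
    obtain ⟨x, hx', hxJ, rfl⟩ := exists_of_face_mem_dom hx
    obtain ⟨y, hy', hyJ, rfl⟩ := exists_of_face_mem_dom hy
    exact (ltPlus_or_of_perpPlus_mk h).elim (not_lt_of_mem_δ hx' hy') (not_lt_of_mem_δ hy' hx')
  ltPlus_irrefl x h := by
    obtain ⟨x, hx, rfl⟩ := exists_mk x
    exact lt_irrefl _ (ltPlus_mk.1 h).1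
  ltPlus_trans x y z := Relation.TransGen.trans
  lt_irrefl x h := by
    obtain ⟨x, hx, rfl⟩ := exists_mk x
    exact ltMinus_irrefl x h
  lt_trans x y z h h' := by
    obtain ⟨x, hx, rfl⟩ := exists_mk x
    obtain ⟨y, hy, rfl⟩ := exists_mk y
    obtain ⟨z, hz, rfl⟩ := exists_mk z
    exact Relation.TransGen.trans (lt_mk.1 h) (lt_mk.1 h')
  ltPlus_linear x y h := by
    obtain ⟨x, hx, rfl⟩ := exists_mk x
    obtain ⟨y, hy, rfl⟩ := exists_mk y
    have hn : ¬ Sim J x y := fun hs => h (mk_eq_mk_iff.2 hs)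
    exact perpPlus_mk_of_comparable
      ((T.ltPlus_linear x y fun h => hn (h ▸ Sim.refl _)).imp Or.inr Or.inr) hn
  disjointness a b := by
    rintro ⟨h, h'⟩
    obtain ⟨a, ha, rfl⟩ := exists_mk a
    obtain ⟨b, hb, rfl⟩ := exists_mk b
    exact T.disjointness a b ⟨h.imp lt_mk.1 lt_mk.1, ltPlus_or_of_perpPlus_mk h'⟩
  lt_le_ltMinus {k} a b h := by
    cases k with
    | zero => exact h
    | succ k =>
      obtain ⟨a, ha, rfl⟩ := exists_mk a
      obtain ⟨b, hb, rfl⟩ := exists_mk b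
      exact ltMinus_mk_of_ltMinus (lt_mk.1 h)
  lt_iff_ltMinus a b hθ := by
    obtain ⟨a, ha, rfl⟩ := exists_mk a
    obtain ⟨b, hb, rfl⟩ := exists_mk b
    refine ⟨fun h => ltMinus_mk_of_ltMinus (lt_mk.1 h), fun h => lt_mk.2 ?_⟩
    obtain ⟨y, hy, h | h⟩ := sim_or_lt_of_ltMinus_mk h
    · have h1 := face_mem_θ_mk (hJ := hJ) (ha := ha) (hu := hJ.γ_notMem a).2 (Or.inr (Sim.refl _))
      have h2 := face_mem_θ_mk (hJ := hJ) (ha := hb) (hu := hJ.γ_notMem a).2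
        (Or.inl ⟨y, hy, h.symm⟩)
      exact (Set.eq_empty_iff_forall_notMem.1 hθ _ ⟨h1, h2⟩).elim
    · exact ltMinus_of_le h.le hy
  pencil_linearity a b hne := by
    rintro ⟨x, hxa, hxb⟩
    obtain ⟨a, ha, rfl⟩ := exists_mk a
    obtain ⟨b, hb, rfl⟩ := exists_mk b
    obtain ⟨x, hx, rfl⟩ := exists_mk x
    have hn : ¬ Sim J a b := fun hs => hne (mk_eq_mk_iff.2 hs)
    have key : (T.ltMinus _ a b ∨ T.ltMinus _ b a) ∨ (a ≤ b ∨ b ≤ a) := by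
      rcases face_mem_θ_mk.1 hxa with ⟨y, hy, hyx⟩ | hax <;>
        rcases face_mem_θ_mk.1 hxb with ⟨z, hz, hzx⟩ | hbx
      · exact hJ.pencil_δδ ha hb hy hz (hyx.trans hzx.symm)
      · exact (hJ.pencil_γδ hb ha hy (hbx.trans hyx.symm)).imp Or.symm Or.symm
      · exact hJ.pencil_γδ ha hb hz (hax.trans hzx.symm)
      · exact hJ.pencil_γγ ha hb (hax.trans hbx.symm)
    exact key.imp (Or.imp lt_mk.2 lt_mk.2) fun h => perpPlus_mk_of_comparable h hn
  pencil_linearity_emptyDomain a b hε hι := by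
    obtain ⟨a, ha, rfl⟩ := exists_mk a
    obtain ⟨b, hb, rfl⟩ := exists_mk b
    have hsub := mk_mem_emptyDomain hε
    obtain ⟨x, hx, hxc, hxs⟩ := face_mem_γSet_domNonloop.1 hι.1
    obtain ⟨y, hy, hyc, q, hq, hqs⟩ := face_mem_δSet_domNonloop.1 hι.2
    refine (hJ.pencil_emptyDomain hsub hx hxc hxs.symm hy hyc hq hqs).imp lt_mk.2
      fun h => ltPlus_mk.2 ⟨h, fun hs => ?_⟩
    -- Equivalent faces have the same domain, and `δ(b)` contains the non-collapsed `x` whereas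
    -- `δ(a)` is in the ideal.
    have hδ : T.δ a = T.δ b := (γδ_eq_of_rel (x := ⟨a, ha⟩) (y := ⟨b, hb⟩) hs).2
    exact hxc (hJ.collapsed_of_mem (hsub (hδ ▸ hx)))
  loop_filling {k} x hx := by
    cases k with
    | zero => exact hx.elim
    | succ k =>
      obtain ⟨x, hxJ, rfl⟩ := exists_mk x
      obtain ⟨α, hα, hαc, hs⟩ := hJ.exists_not_collapsed_sim_γ hxJ (mk_mem_loops.1 hx)
      exact ⟨hJ.faceMk α hα, fun h => hαc (mk_mem_loops.1 h), mk_eq_mk_iff.2 hs⟩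

/-! ### The quotient map -/

theorem quotientMap_of_mem {k : ℕ} {a : T.Face (k + 1)} (h : a ∈ J (k + 1)) :
    T.quotientMap J hJ (k + 1) a = Cell.empty (hJ.faceMk (T.γ a) (hJ.γ_notMem a)) := dif_pos h

theorem quotientMap_of_notMem {k : ℕ} {a : T.Face k} (h : a ∉ J k) :
    T.quotientMap J hJ k a = Cell.face (hJ.faceMk a h) := by
  cases k with
  | zero => rfl
  | succ k => exact dif_neg h

theorem quotientMap_eq_face_iff {k : ℕ} {a : T.Face k} {c : (T.quotient J hJ).Face k} :
    T.quotientMap J hJ k a = Cell.face c ↔ ∃ h : a ∉ J k, c = hJ.faceMk a h := by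
  constructor
  · intro h
    by_cases ha : a ∈ J k
    · cases k with
      | zero => exact (hJ.notMem_zero a ha).elim
      | succ k =>
        rw [quotientMap_of_mem ha] at h
        cases h
    · rw [quotientMap_of_notMem ha] at h
      exact ⟨ha, (Cell.face.inj h).symm⟩
  · rintro ⟨h, rfl⟩
    exact quotientMap_of_notMem h

theorem ker_quotientMap : OrderedHypergraph.ker (T := T.toOrderedHypergraph)
    (S := T.quotient J hJ) (T.quotientMap J hJ) = J := by
  funext k
  ext a
  cases k with
  | zero => exact iff_of_false (fun h => h) (hJ.notMem_zero a)
  | succ k =>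
    constructor
    · rintro ⟨c, h⟩
      by_contra ha
      change _ = T.quotientMap J hJ (k + 1) a at h
      rw [quotientMap_of_notMem ha] at h
      cases h
    · exact fun ha => ⟨_, (quotientMap_of_mem ha).symm⟩

theorem mem_image_dom {k : ℕ} {a : T.Face (k + 1)} {c : Cell (T.quotient J hJ).Face k} :
    c ∈ OrderedHypergraph.image (T := T.toOrderedHypergraph) (S := T.quotient J hJ)
      (T.quotientMap J hJ) (T.toOrderedHypergraph.dom a) ↔
      ∃ x ∈ T.δ a, c = T.quotientMap J hJ k x := by
  cases k with
  | zero =>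
    constructor
    · rintro ⟨x, ⟨y, hy, h⟩, rfl⟩
      cases h
      exact ⟨x, hy, rfl⟩
    · rintro ⟨x, hx, rfl⟩
      exact ⟨x, ⟨x, hx, rfl⟩, rfl⟩
  | succ k =>
    constructor
    · rintro (⟨x, ⟨y, hy, h⟩, rfl⟩ | ⟨x, y, ⟨z, hz, h⟩, -⟩)
      · cases h
        exact ⟨x, hy, rfl⟩
      · cases h
    · rintro ⟨x, hx, rfl⟩
      exact Or.inl ⟨x, ⟨x, hx, rfl⟩, rfl⟩

theorem oneEq_of_eq {S : Hypergraph.{u}} {k : ℕ} {A B : Set (Cell S.Face k)} (h : A = B) :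
    S.OneEq A B := by
  subst h
  cases k <;> rfl

theorem face_mem_image_dom {k : ℕ} {a : T.Face (k + 1)} {ha : a ∉ J (k + 1)}
    (c : (T.quotient J hJ).Face k) :
    Cell.face c ∈ OrderedHypergraph.image (T := T.toOrderedHypergraph) (S := T.quotient J hJ)
      (T.quotientMap J hJ) (T.toOrderedHypergraph.dom a) ↔
      Cell.face c ∈ (T.quotient J hJ).dom (hJ.faceMk a ha) := by
  rw [mem_image_dom]
  constructor
  · rintro ⟨x, hx, h⟩
    obtain ⟨hxJ, rfl⟩ := quotientMap_eq_face_iff.1 h.symm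
    exact face_mem_dom_mk.2 ⟨x, hx, Sim.refl _⟩
  · intro h
    obtain ⟨x, hx, hxJ, rfl⟩ := exists_of_face_mem_dom h
    exact ⟨x, hx, (quotientMap_of_notMem hxJ).symm⟩

theorem quotientMap_map_δ {k : ℕ} (a : T.Face (k + 1)) :
    (T.quotient J hJ).OneEq
      (OrderedHypergraph.image (T := T.toOrderedHypergraph) (S := T.quotient J hJ)
        (T.quotientMap J hJ) (T.toOrderedHypergraph.dom a))
      ((T.quotient J hJ).δ (T.quotientMap J hJ (k + 1) a)) := by
  by_cases ha : a ∈ J (k + 1)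
  · refine oneEq_of_eq ?_
    rw [quotientMap_of_mem ha]
    obtain ⟨x, hx⟩ := hJ.exists_δ_eq ha
    have hstep : Step J k x (T.γ a) := ⟨a, ha, hx, rfl⟩
    have hq : T.quotientMap J hJ k x = Cell.face (hJ.faceMk (T.γ a) (hJ.γ_notMem a)) :=
      quotientMap_eq_face_iff.2 ⟨hJ.notMem_left_of_step hstep, mk_eq_mk_iff.2 hstep.sim.symm⟩
    ext c
    rw [mem_image_dom, hx]
    constructor
    · rintro ⟨_, rfl, rfl⟩
      exact hq
    · intro h
      exact ⟨x, rfl, (show c = _ from h).trans hq.symm⟩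
  · rw [quotientMap_of_notMem ha]
    change (T.quotient J hJ).OneEq _ ((T.quotient J hJ).dom (hJ.faceMk a ha))
    cases k with
    | zero =>
      change _ = _
      ext c
      cases c with
      | face c => exact face_mem_image_dom c
    | succ k =>
      have hempty : ∀ u hu, Cell.empty (hJ.faceMk u hu) ∈
          OrderedHypergraph.image (T := T.toOrderedHypergraph) (S := T.quotient J hJ)
            (T.quotientMap J hJ) (T.toOrderedHypergraph.dom a) ↔
          ∃ x ∈ T.δ a, x ∈ J (k + 1) ∧ Sim J u (T.γ x) := by
        intro u hu
        rw [mem_image_dom]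
        constructor
        · rintro ⟨x, hx, h⟩
          by_cases hxJ : x ∈ J (k + 1)
          · rw [quotientMap_of_mem hxJ] at h
            exact ⟨x, hx, hxJ, empty_mk_eq_iff.1 h⟩
          · rw [quotientMap_of_notMem hxJ] at h
            cases h
        · rintro ⟨x, hx, hxJ, h⟩
          refine ⟨x, hx, ?_⟩
          rw [quotientMap_of_mem hxJ]
          exact empty_mk_eq_iff.2 h
      refine oneEq_of_face_iff_of_empty_imp face_mem_image_dom ?_ ?_
      · intro u hu
        obtain ⟨u, huJ, rfl⟩ := exists_mk u
        obtain ⟨x, hx, hxJ, hs⟩ := (hempty u huJ).1 hu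
        by_cases hsub : T.δ a ⊆ J (k + 1)
        · exact Or.inl (empty_mem_dom_mk.2 ⟨hsub, hs.trans (hJ.sim_γγ_of_δ_subset hsub hx)⟩)
        -- The image contains `1_{[γ(x)]}` for the ideal faces `x ∈ δ(a)`; each is absorbed because
        -- `[γ(x)]` lies in `θ[y]` for some `y ∈ δ(a)` outside the ideal.
        · obtain ⟨y, hy, hyJ, h⟩ := hJ.exists_notMem_δ hsub hx
          exact Or.inr ⟨hJ.faceMk y hyJ, face_mem_dom_mk.2 ⟨y, hy, Sim.refl _⟩, hJ.faceMk u huJ,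
            face_mem_θ_mk.2 (h.symm.imp (fun ⟨w, hw, h⟩ => ⟨w, hw, h.trans hs.symm⟩)
              fun h => h.trans hs.symm), rfl⟩
      · intro u hu
        obtain ⟨u, huJ, rfl⟩ := exists_mk u
        obtain ⟨hsub, hs⟩ := empty_mem_dom_mk.1 hu
        obtain ⟨x, hx⟩ := T.δ_nonempty a
        exact Or.inl ((hempty u huJ).2
          ⟨x, hx, hsub hx, hs.trans (hJ.sim_γγ_of_δ_subset hsub hx).symm⟩)

theorem quotientMap_isCollapsingMorphism : OrderedHypergraph.IsCollapsingMorphism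
    (T := T.toOrderedHypergraph) (S := T.quotient J hJ) (T.quotientMap J hJ) where
  map_lt a b a' b' h ha hb := by
    obtain ⟨haJ, rfl⟩ := quotientMap_eq_face_iff.1 ha
    obtain ⟨hbJ, rfl⟩ := quotientMap_eq_face_iff.1 hb
    exact lt_mk.2 h
  map_γ {k} a := by
    refine (quotientMap_of_notMem (hJ.γ_notMem a)).trans ?_
    by_cases ha : a ∈ J (k + 1)
    · rw [quotientMap_of_mem ha]
      rfl
    · rw [quotientMap_of_notMem ha]
      rfl
  map_δ a := quotientMap_map_δ a

end IsIdeal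

end PositiveFaceStructure

end FaceStructures

theorem mainTheorem7 (T : FaceStructures.PositiveFaceStructure.{u})
    (J : (k : ℕ) → Set (T.Face k)) (hJ : T.IsIdeal J) :
    (T.quotient J hJ).IsOrderedFaceStructure ∧
    FaceStructures.OrderedHypergraph.IsCollapsingMorphism
      (T := T.toOrderedHypergraph) (S := T.quotient J hJ) (T.quotientMap J hJ) ∧
    FaceStructures.OrderedHypergraph.ker
      (T := T.toOrderedHypergraph) (S := T.quotient J hJ) (T.quotientMap J hJ) = J :=
  ⟨hJ.quotient_isOrderedFaceStructure, hJ.quotientMap_isCollapsingMorphism, hJ.ker_quotientMap⟩
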